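/- All Lie algebras are over $\mathbb{C}$. Let $R$ be a set of elements of a free Lie algebra $\mathfrak{f}_Y$ on a set $Y$. The variety defined by $R$ is the class of all Lie algebras $\mathfrak{g}$ such that $\varphi(r)=0$ for every $r\in R$ and every homomorphism $\varphi\colon\mathfrak{f}_Y\to\mathfrak{g}$. For a set $X$, the free Lie algebra of this variety with generating set $X$ is the quotient of the free Lie algebra $\mathfrak{f}_X$ by the ideal generated by all $\varphi(r)$, where $r\in R$ and $\varphi\colon\mathfrak{f}_Y\to\mathfrak{f}_X$ is a homomorphism. A finitely generated nilpotent Lie algebra is called pseudo-free if it is isomorphic to a free Lie algebra of some variety. Let $m$ and $\nu$ be non-negative integers with $\nu\le 5$ or $(m,\nu)=(2,6)$. Then there are, up to isomorphism, only finitely many pseudo-free Lie algebras that have a minimal (irredundant) generating set with exactly $m$ elements and whose nilpotency index (the least $k$ such that all brackets of $k+1$ elements vanish, which is $0$ for the zero algebra) is equal to $\nu$. -/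

import Mathlib

universe u v w

/-- Let `R` be a set of Lie polynomials (identities) in the variables `Y`, and let `L` be a complex
Lie algebra. This is the ideal of `L` generated by all the values `φ r`, where `r ∈ R` and
`φ : FreeLieAlgebra ℂ Y → L` is a homomorphism (a substitution of elements of `L` for the
variables). It vanishes if and only if `L` lies in the variety of Lie algebras defined by the
identities `R`, and the quotient of `L` by it is the largest quotient of `L` in that variety. -/
def identityIdeal {Y : Type v} (R : Set (FreeLieAlgebra ℂ Y))
    (L : Type u) [LieRing L] [LieAlgebra ℂ L] : LieIdeal ℂ L :=
  LieSubmodule.lieSpan ℂ L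
    {z : L | ∃ φ : FreeLieAlgebra ℂ Y →ₗ⁅ℂ⁆ L, ∃ r ∈ R, φ r = z}

/-- The free Lie algebra, with generating set `X`, of the variety of complex Lie algebras that is
defined by the identities `R`: the largest quotient of the free Lie algebra on `X` that lies in
the variety. -/
abbrev VarietyFreeLieAlgebra {Y : Type v} (R : Set (FreeLieAlgebra ℂ Y)) (X : Type w) : Type w :=
  FreeLieAlgebra ℂ X ⧸ identityIdeal R (FreeLieAlgebra ℂ X)

/-- A complex Lie algebra is pseudo-free if it is finitely generated, nilpotent, and isomorphic to
a free Lie algebra (on some generating set `X`) of some variety of Lie algebras. -/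
def IsPseudoFree (L : Type u) [LieRing L] [LieAlgebra ℂ L] : Prop :=
  (∃ S : Finset L, LieSubalgebra.lieSpan ℂ L (S : Set L) = ⊤) ∧
  LieRing.IsNilpotent L ∧
  ∃ (Y : Type) (R : Set (FreeLieAlgebra ℂ Y)) (X : Type),
    Nonempty (L ≃ₗ⁅ℂ⁆ VarietyFreeLieAlgebra R X)

/-- `L` has a minimal (that is, irredundant) generating set with exactly `m` elements. -/
def IsMinimallyGeneratedBy (L : Type u) [LieRing L] [LieAlgebra ℂ L] (m : ℕ) : Prop :=
  ∃ S : Finset L,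
    Minimal (fun T : Finset L => LieSubalgebra.lieSpan ℂ L (T : Set L) = ⊤) S ∧ S.card = m

/-- The collection of all complex Lie algebras (in a given universe). -/
structure ComplexLieAlgebra : Type (u + 1) where
  carrier : Type u
  [lieRing : LieRing carrier]
  [lieAlgebra : LieAlgebra ℂ carrier]

attribute [instance] ComplexLieAlgebra.lieRing ComplexLieAlgebra.lieAlgebra

/-- Isomorphism of complex Lie algebras, as an equivalence relation. -/
def ComplexLieAlgebra.isoSetoid : Setoid ComplexLieAlgebra.{u} where
  r L L' := Nonempty (L.carrier ≃ₗ⁅ℂ⁆ L'.carrier)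
  iseqv :=
    { refl := fun _ => ⟨LieEquiv.refl⟩
      symm := fun ⟨e⟩ => ⟨e.symm⟩
      trans := fun ⟨e⟩ ⟨f⟩ => ⟨e.trans f⟩ }

/-!
A pseudo-free Lie algebra with an `m`-element generating set is the quotient of a free Lie algebra
`F` of rank `k ≤ m` by a fully invariant ideal, that is, an ideal that is stable under all
substitutions of elements for the generators (`IsPseudoFree.exists_presentation`). Hence it suffices
to show that there are finitely many fully invariant subspaces `I` of `F` that contain everything of
degree larger than `ν`. Dilations of the generators show that `I` is the sum of its homogeneous
components (`IsFullyInvariant.le_of_forall_inf_wordSpan_le`), so each degree `n ≤ ν` can be treated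
separately. In representation theoretic terms, the component of degree `n` of `F` is a
multiplicity-free `GL k`-module if `n ≤ 5` or if `k ≤ 2` and `n = 6`, and a multiplicity-free module
has only finitely many submodules. The proof below makes this explicit: it exhibits an operator that
preserves identities and has a simple spectrum, and every subspace that is invariant under such an
operator is spanned by some of its eigenvectors (`finite_invariant_of_simple_spectrum`,
`finite_inf_wordSpan`).

For `n ≤ 5`, full polarization (`IsFullyInvariant.polarization_mem`) reduces the question to
multilinear identities in `n` variables. By the Jacobi identity these are spanned by the `(n - 1)!`
left-normed brackets that start with a fixed variable. The symmetric group acts on them by renaming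
of the variables; the eigenvalues of the Jucys–Murphy elements are the contents of the boxes of
standard Young tableaux, and they separate the tableaux. As the multilinear component is
multiplicity-free, a generic combination of these elements has a simple spectrum
(`FormalSum.isSpectralTable_jucysMurphy`).

For `n = 6` and two generators, the homogeneous component is spanned by nine left-normed brackets.
The operator is here the product of the raising and the lowering operator of `𝔰𝔩₂`, plus a
multiple of a dilation of one generator (`FormalSum.isSpectralTable_binaryCasimir`). The raising and
lowering operators preserve identities since they are the linear coefficients in `t` of the
substitutions `x ↦ x + t y` and `y ↦ y + t x`.

All computations take place with formal integral combinations of words (`FormalSum`), where a word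
stands for a left-normed bracket of letters.
-/

/-! ### Submodules invariant under an operator with simple spectrum -/

/-- If a sum of eigenvectors with distinct eigenvalues lies in an invariant submodule, then so
does every summand. -/
theorem mem_of_sum_eigenvectors_mem {ι E : Type*} [AddCommGroup E] [Module ℂ E]
    (T : E →ₗ[ℂ] E) (N : Submodule ℂ E) (hN : ∀ x ∈ N, T x ∈ N) (μ : ι → ℂ) (s : Finset ι)
    (hμ : Set.InjOn μ s) (v : ι → E) (hv : ∀ i ∈ s, T (v i) = μ i • v i)
    (hs : ∑ i ∈ s, v i ∈ N) : ∀ i ∈ s, v i ∈ N := by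
  classical
  induction s using Finset.induction_on generalizing v with
  | empty => simp
  | insert j s hj ih =>
    have hj' : ∀ i ∈ s, μ i - μ j ≠ 0 := fun i hi h => hj <| by
      rwa [← hμ (by simp [hi]) (by simp) (sub_eq_zero.1 h)]
    have key : ∀ i ∈ s, (μ i - μ j) • v i ∈ N := by
      refine ih (hμ.mono (by simp)) (fun i => (μ i - μ j) • v i) (fun i hi => ?_) ?_
      · rw [map_smul, hv i (by simp [hi]), smul_comm]
      · have h1 := N.sub_mem (hN _ hs) (N.smul_mem (μ j) hs)
        rw [map_sum, Finset.smul_sum, ← Finset.sum_sub_distrib, Finset.sum_insert hj,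
          hv j (by simp), sub_self, zero_add] at h1
        simpa only [sub_smul] using (Finset.sum_congr rfl fun i hi => by
          rw [hv i (by simp [hi])] : ∑ i ∈ s, (T (v i) - μ j • v i) = _) ▸ h1
    have key' : ∀ i ∈ s, v i ∈ N := fun i hi => by
      simpa [smul_smul, hj' i hi] using N.smul_mem (μ i - μ j)⁻¹ (key i hi)
    rw [Finset.sum_insert hj] at hs
    have := (N.add_mem_iff_left (N.sum_mem key')).1 hs
    simpa [Finset.forall_mem_insert] using ⟨this, key'⟩

/-- A polynomial function of a complex variable with values in a submodule has all its coefficients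
there. -/
theorem coeff_mem_of_forall_sum_pow_smul_mem {E : Type*} [AddCommGroup E] [Module ℂ E]
    (N : Submodule ℂ E) (m : ℕ) (p : ℕ → E)
    (h : ∀ t : ℂ, ∑ k ∈ Finset.range m, t ^ k • p k ∈ N) : ∀ k < m, p k ∈ N := by
  induction m generalizing p with
  | zero => simp
  | succ m ih =>
    have key : ∀ k < m, ((2 : ℂ) ^ k - 2 ^ m) • p k ∈ N := by
      refine ih _ fun t => ?_
      -- `p (2 t) - 2 ^ m p (t)` has smaller degree
      have h1 := N.sub_mem (h (2 * t)) (N.smul_mem (2 ^ m) (h t))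
      rw [Finset.sum_range_succ, Finset.sum_range_succ, smul_add, Finset.smul_sum,
        add_sub_add_comm, ← Finset.sum_sub_distrib, mul_pow, smul_smul, sub_self, add_zero] at h1
      have h2 : ∀ k, (2 * t) ^ k • p k - (2 ^ m : ℂ) • t ^ k • p k =
          t ^ k • ((2 : ℂ) ^ k - 2 ^ m) • p k := fun k => by
        rw [mul_pow, smul_smul, smul_smul, ← sub_smul]
        congr 1
        ring
      simpa only [h2] using h1
    have hlt : ∀ k < m, p k ∈ N := fun k hk => by
      have hne : ((2 : ℂ) ^ k - 2 ^ m) ≠ 0 := by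
        rw [sub_ne_zero]
        exact_mod_cast (Nat.pow_lt_pow_right (by norm_num : 1 < 2) hk).ne
      simpa [smul_smul, hne] using N.smul_mem ((2 : ℂ) ^ k - 2 ^ m)⁻¹ (key k hk)
    have h1 := h 1
    simp only [one_pow, one_smul, Finset.sum_range_succ] at h1
    have hm := (N.add_mem_iff_right (N.sum_mem fun k hk => hlt k (Finset.mem_range.1 hk))).1 h1
    intro k hk
    rcases Nat.lt_succ_iff_lt_or_eq.1 hk with h' | rfl
    exacts [hlt k h', hm]

/-- A square matrix of size `d` with `d` distinct eigenvalues has only finitely many invariant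
subspaces, as each of them is spanned by eigenvectors. -/
theorem finite_invariant_of_simple_spectrum {d : ℕ} (M : Matrix (Fin d) (Fin d) ℂ)
    (μ : Fin d → ℂ) (hμ : Function.Injective μ) (V : Fin d → Fin d → ℂ) (hV : ∀ j, V j ≠ 0)
    (hM : ∀ j, Matrix.vecMul (V j) M = μ j • V j) :
    {N : Submodule ℂ (Fin d → ℂ) | ∀ c ∈ N, Matrix.vecMul c M ∈ N}.Finite := by
  let T : Module.End ℂ (Fin d → ℂ) := M.vecMulLinear
  have hT : ∀ j, T (V j) = μ j • V j := hM
  have hli : LinearIndependent ℂ V :=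
    Module.End.eigenvectors_linearIndependent' T μ hμ V fun j =>
      ⟨Module.End.mem_eigenspace_iff.2 (hT j), hV j⟩
  have hspan : Submodule.span ℂ (Set.range V) = ⊤ :=
    hli.span_eq_top_of_card_eq_finrank' (by simp)
  refine Set.Finite.of_finite_image (f := fun N => {j | V j ∈ N}) (Set.toFinite _) ?_
  have hle : ∀ N : Submodule ℂ (Fin d → ℂ), (∀ c ∈ N, Matrix.vecMul c M ∈ N) →
      ∀ N' : Submodule ℂ (Fin d → ℂ), {j | V j ∈ N} ⊆ {j | V j ∈ N'} → N ≤ N' := by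
    intro N hN N' hNN' x hx
    obtain ⟨c, rfl⟩ := (Submodule.mem_span_range_iff_exists_fun ℂ).1
      (hspan ▸ Submodule.mem_top (x := x))
    have key := mem_of_sum_eigenvectors_mem T N hN μ Finset.univ hμ.injOn (fun j => c j • V j)
      (fun j _ => by rw [map_smul, hT, smul_comm]) hx
    refine N'.sum_mem fun j hj => ?_
    by_cases hc : c j = 0
    · simp [hc]
    · refine N'.smul_mem _ (hNN' ?_)
      simpa [smul_smul, hc] using N.smul_mem (c j)⁻¹ (key j hj)
  intro N hN N' hN' h
  exact le_antisymm (hle N hN N' h.le) (hle N' hN' N h.ge)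

/-! ### Left-normed brackets -/

section LeftNormed

variable {L : Type u} [LieRing L]

/-- The left-normed bracket `⁅⁅⁅a, b⁆, c⁆, …⁆` of a list `[a, b, c, …]`; the empty list gives
`0`. -/
def leftNormed : List L → L
  | [] => 0
  | a :: l => l.foldl (fun x y => ⁅x, y⁆) a

theorem leftNormed_append {l : List L} (hl : l ≠ []) (l' : List L) :
    leftNormed (l ++ l') = l'.foldl (fun x y => ⁅x, y⁆) (leftNormed l) := by
  cases l with
  | nil => exact absurd rfl hl
  | cons a l => simp [leftNormed]

theorem leftNormed_concat {l : List L} (hl : l ≠ []) (a : L) :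
    leftNormed (l ++ [a]) = ⁅leftNormed l, a⁆ := by
  simp [leftNormed_append hl]

theorem map_leftNormed [LieAlgebra ℂ L] {L' : Type*} [LieRing L'] [LieAlgebra ℂ L']
    (f : L →ₗ⁅ℂ⁆ L') (l : List L) :
    f (leftNormed l) = leftNormed (l.map f) := by
  induction l using List.reverseRecOn with
  | nil => simp [leftNormed]
  | append_singleton l a ih =>
    rcases eq_or_ne l [] with rfl | hl
    · simp [leftNormed]
    · rw [leftNormed_concat hl, LieHom.map_lie, ih, List.map_append, List.map_singleton,
        leftNormed_concat (by simpa using hl)]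

theorem leftNormed_mem_lowerCentralSeries (l : List L) :
    leftNormed l ∈ LieModule.lowerCentralSeries ℤ L L (l.length - 1) := by
  induction l using List.reverseRecOn with
  | nil => simp [leftNormed]
  | append_singleton l a ih =>
    rcases eq_or_ne l [] with rfl | hl
    · simp
    · obtain ⟨k, hk⟩ : ∃ k, l.length = k + 1 := ⟨l.length - 1, by
        have := List.length_pos_of_ne_nil hl; omega⟩
      rw [leftNormed_concat hl, ← lie_skew, List.length_append, hk]
      rw [hk] at ih
      simp only [List.length_singleton, Nat.add_sub_cancel] at ih ⊢
      rw [LieModule.lowerCentralSeries_succ]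
      exact neg_mem (LieSubmodule.lie_mem_lie (LieSubmodule.mem_top _) ih)

variable [LieAlgebra ℂ L]

/-- The linear map `x ↦ ⁅⁅⁅x, a⁆, b⁆, …⁆` for a list `[a, b, …]`. -/
def adTail : List L → L →ₗ[ℂ] L
  | [] => LinearMap.id
  | a :: l => adTail l ∘ₗ (-(LieAlgebra.ad ℂ L a : L →ₗ[ℂ] L))

theorem adTail_apply (l : List L) (x : L) :
    adTail l x = l.foldl (fun x y => ⁅x, y⁆) x := by
  induction l generalizing x with
  | nil => rfl
  | cons a l ih =>
    rw [List.foldl_cons, ← ih, ← lie_skew]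
    rfl

theorem adTail_append (l l' : List L) (x : L) : adTail (l ++ l') x = adTail l' (adTail l x) := by
  simp [adTail_apply]

theorem adTail_cons (a : L) (l : List L) (x : L) : adTail (a :: l) x = adTail l ⁅x, a⁆ := by
  simp [adTail_apply]

theorem leftNormed_cons (a : L) (l : List L) : leftNormed (a :: l) = adTail l a := by
  simp [adTail_apply, leftNormed]

theorem leftNormed_append_eq_adTail {l : List L} (hl : l ≠ []) (l' : List L) :
    leftNormed (l ++ l') = adTail l' (leftNormed l) := by
  rw [leftNormed_append hl, adTail_apply]

end LeftNormed

/-! ### Integral combinations of words -/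

/-- Formal integral linear combinations of words in the letters `0, 1, 2, …`, as lists of
coefficients and words. Every word stands for a left-normed bracket. -/
abbrev FormalSum := List (ℤ × List ℕ)

namespace FormalSum

/-- The sum of the coefficients of a word. -/
def coeff (A : FormalSum) (w : List ℕ) : ℤ := (A.map fun p => bif p.2 == w then p.1 else 0).sum

/-- Multiplication by an integer. -/
def scale (k : ℤ) (A : FormalSum) : FormalSum := A.map fun p => (k * p.1, p.2)

/-- The linear extension of a map from words to formal sums. -/
def bind (A : FormalSum) (f : List ℕ → FormalSum) : FormalSum :=
  A.flatMap fun p => scale p.1 (f p.2)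

section Eval

variable {L : Type u} [LieRing L]

/-- The value of a formal sum under the substitution `z` of elements of `L` for the letters. -/
def eval (z : ℕ → L) (A : FormalSum) : L := (A.map fun p => p.1 • leftNormed (p.2.map z)).sum

/-- The value of a formal sum under the substitution `z` when `x` is put in front of every
word. -/
def evalAfter [LieAlgebra ℂ L] (z : ℕ → L) (x : L) (A : FormalSum) : L :=
  (A.map fun p => p.1 • adTail (p.2.map z) x).sum

@[simp] theorem eval_nil (z : ℕ → L) : eval z [] = 0 := rfl

@[simp] theorem eval_cons (z : ℕ → L) (p : ℤ × List ℕ) (A : FormalSum) :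
    eval z (p :: A) = p.1 • leftNormed (p.2.map z) + eval z A := by
  simp [eval]

theorem eval_append (z : ℕ → L) (A A' : FormalSum) : eval z (A ++ A') = eval z A + eval z A' := by
  simp [eval]

theorem eval_scale (z : ℕ → L) (k : ℤ) (A : FormalSum) : eval z (scale k A) = k • eval z A := by
  induction A with
  | nil => simp [scale]
  | cons p A ih =>
    rw [eval_cons, smul_add, ← ih]
    simp [scale, mul_smul]

theorem eval_bind (z : ℕ → L) (A : FormalSum) (f : List ℕ → FormalSum)
    (hf : ∀ p ∈ A, eval z (f p.2) = leftNormed (p.2.map z)) : eval z (bind A f) = eval z A := by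
  induction A with
  | nil => rfl
  | cons p A ih =>
    rw [eval_cons, ← ih fun q hq => hf q (by simp [hq]), ← hf p (by simp), ← eval_scale,
      ← eval_append]
    rfl

theorem eval_eq_sum_coeff (z : ℕ → L) (A : FormalSum) {d : ℕ} (W : Fin d → List ℕ)
    (hW : Function.Injective W) (hA : ∀ p ∈ A, p.2 ∈ Set.range W) :
    eval z A = ∑ i, A.coeff (W i) • leftNormed ((W i).map z) := by
  induction A with
  | nil => simp [coeff]
  | cons p A ih =>
    obtain ⟨j, hj⟩ := hA p (by simp)
    rw [eval_cons, ih fun q hq => hA q (by simp [hq])]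
    have : ∀ i, coeff (p :: A) (W i) = (if i = j then p.1 else 0) + coeff A (W i) := by
      intro i
      simp only [coeff, List.map_cons, List.sum_cons, ← hj, Bool.cond_eq_ite, beq_iff_eq,
        hW.eq_iff, eq_comm (a := i)]
    simp [this, add_smul, Finset.sum_add_distrib, ite_smul, hj]

end Eval

end FormalSum

/-! ### Rewriting of brackets by the Jacobi identity -/

namespace FormalSum

/-- The step `v ↦ v c - c v` of the expansion of a left-normed bracket as a commutator. -/
def expandStep (A : FormalSum) (c : ℕ) : FormalSum :=
  (A.map fun p => (p.1, p.2 ++ [c])) ++ A.map fun p => (-p.1, c :: p.2)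

/-- The expansion of a left-normed bracket `⁅⁅a, b⁆, …⁆` as an iterated commutator in the free
associative algebra. -/
def expand : List ℕ → FormalSum
  | [] => []
  | a :: l => l.foldl expandStep [(1, [a])]

theorem perm_of_mem_expand {l : List ℕ} {p : ℤ × List ℕ} (hp : p ∈ expand l) : p.2.Perm l := by
  cases l with
  | nil => simp [expand] at hp
  | cons a l =>
    have key : ∀ (l : List ℕ) (A : FormalSum) (m : List ℕ), (∀ p ∈ A, p.2.Perm m) →
        ∀ p ∈ l.foldl expandStep A, p.2.Perm (m ++ l) := by
      intro l
      induction l with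
      | nil => intro A m hA; simpa using hA
      | cons c l ih =>
        intro A m hA p hp
        have := ih (expandStep A c) (m ++ [c]) ?_ p hp
        · simpa using this
        · intro q hq
          simp only [expandStep, List.mem_append, List.mem_map] at hq
          rcases hq with ⟨r, hr, rfl⟩ | ⟨r, hr, rfl⟩
          · exact (hA r hr).append_right _
          · exact ((hA r hr).cons c).trans (List.perm_append_comm (l₁ := [c]))
    exact key l [(1, [a])] [a] (by simp) p hp

section

variable {L : Type u} [LieRing L] [LieAlgebra ℂ L]

theorem evalAfter_append (z : ℕ → L) (x : L) (A A' : FormalSum) :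
    evalAfter z x (A ++ A') = evalAfter z x A + evalAfter z x A' := by
  simp [evalAfter]

theorem evalAfter_cons (z : ℕ → L) (x : L) (p : ℤ × List ℕ) (A : FormalSum) :
    evalAfter z x (p :: A) = p.1 • adTail (p.2.map z) x + evalAfter z x A := by
  simp [evalAfter]

theorem evalAfter_expandStep (z : ℕ → L) (x : L) (A : FormalSum) (c : ℕ) :
    evalAfter z x (expandStep A c) = ⁅evalAfter z x A, z c⁆ - evalAfter z ⁅x, z c⁆ A := by
  rw [expandStep, evalAfter_append, sub_eq_add_neg]
  congr 1
  · induction A with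
    | nil => simp [evalAfter]
    | cons p A ih =>
      rw [List.map_cons, evalAfter_cons, evalAfter_cons, ih, add_lie, smul_lie]
      simp [adTail_append, adTail]
  · induction A with
    | nil => simp [evalAfter]
    | cons p A ih =>
      rw [List.map_cons, evalAfter_cons, evalAfter_cons, ih, neg_add]
      simp [adTail_cons]

/-- By the Jacobi identity, the bracket with a left-normed bracket is the corresponding iterated
commutator of brackets with letters. -/
theorem lie_leftNormed (z : ℕ → L) (x : L) (l : List ℕ) :
    ⁅x, leftNormed (l.map z)⁆ = evalAfter z x (expand l) := by
  cases l with
  | nil => simp [leftNormed, expand, evalAfter]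
  | cons a l =>
    have key : ∀ (l : List ℕ) (A : FormalSum) (y : L), (∀ x, ⁅x, y⁆ = evalAfter z x A) →
        ∀ x, ⁅x, (l.map z).foldl (fun x y => ⁅x, y⁆) y⁆ = evalAfter z x (l.foldl expandStep A) := by
      intro l
      induction l with
      | nil => intro A y h; exact h
      | cons c l ih =>
        intro A y h
        refine ih _ _ fun x => ?_
        rw [evalAfter_expandStep, ← h, ← h, leibniz_lie, ← lie_skew y ⁅x, z c⁆, sub_eq_add_neg]
    exact key l _ _ (fun x => by simp [evalAfter, adTail]) x

theorem eval_map_prefix (z : ℕ → L) (k : ℤ) {u : List ℕ} (hu : u ≠ []) (v : List ℕ)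
    (A : FormalSum) :
    eval z (A.map fun p => (k * p.1, u ++ (p.2 ++ v))) =
      adTail (v.map z) (k • evalAfter z (leftNormed (u.map z)) A) := by
  induction A with
  | nil => simp [evalAfter]
  | cons p A ih =>
    rw [List.map_cons, eval_cons, ih, evalAfter_cons, smul_add, map_add]
    congr 1
    rw [List.map_append, leftNormed_append_eq_adTail (by simpa using hu), List.map_append,
      adTail_append, smul_smul, map_zsmul]

/-- The Lie relation that expresses `⁅u, v⁆ + ⁅v, u⁆ = 0` for left-normed brackets `u`, `v`. -/
theorem eval_antisymm (z : ℕ → L) {u v : List ℕ} (hu : u ≠ []) (hv : v ≠ []) :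
    eval z ((expand v).map fun p => (1 * p.1, u ++ (p.2 ++ []))) +
      eval z ((expand u).map fun p => (1 * p.1, v ++ (p.2 ++ []))) = 0 := by
  rw [eval_map_prefix z 1 hu, eval_map_prefix z 1 hv, ← lie_leftNormed, ← lie_leftNormed,
    ← lie_skew (leftNormed (u.map z))]
  simp only [List.map_nil, adTail, one_smul, LinearMap.id_apply, neg_add_cancel]

end

/-- A formal sum of words that start with the letter `0` and whose value is the left-normed bracket
of the given word, if the letter `0` occurs in it. -/
def headNormal (l : List ℕ) : FormalSum :=
  match l.takeWhile (fun x => x != 0), l.dropWhile (fun x => x != 0) with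
  | [], _ => [(1, l)]
  | _, [] => [(1, l)]
  | u, _ :: v => (expand u).map fun p => (-1 * p.1, [0] ++ (p.2 ++ v))

theorem headNormal_zero_cons (l : List ℕ) : headNormal (0 :: l) = [(1, 0 :: l)] := by
  simp [headNormal]

theorem headNormal_append {u : List ℕ} (hu : u ≠ []) (hu' : 0 ∉ u) (v : List ℕ) :
    headNormal (u ++ 0 :: v) = (expand u).map fun p => (-1 * p.1, [0] ++ (p.2 ++ v)) := by
  have h1 : (u ++ 0 :: v).takeWhile (fun x => x != 0) = u := by
    rw [List.takeWhile_append_of_pos] <;> simp_all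
    rintro a ha rfl; exact hu' ha
  have h2 : (u ++ 0 :: v).dropWhile (fun x => x != 0) = 0 :: v := by
    rw [List.dropWhile_append_of_pos] <;> simp_all
    rintro a ha rfl; exact hu' ha
  obtain ⟨a, u, rfl⟩ := List.exists_cons_of_ne_nil hu
  rw [headNormal, h1, h2]

theorem eval_headNormal {L : Type u} [LieRing L] [LieAlgebra ℂ L] (z : ℕ → L) {l : List ℕ}
    (hl : 0 ∈ l) : eval z (headNormal l) = leftNormed (l.map z) := by
  obtain ⟨u, v, rfl, h⟩ := List.eq_append_cons_of_mem hl
  rcases eq_or_ne u [] with rfl | hu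
  · simp [headNormal_zero_cons]
  · rw [headNormal_append hu h, eval_map_prefix z _ (by simp), ← lie_leftNormed, List.map_append,
      leftNormed_append_eq_adTail (by simpa using hu), List.map_cons (l := v), adTail_cons,
      ← lie_skew (leftNormed (u.map z))]
    simp [leftNormed]

theorem mem_headNormal {l : List ℕ} (hl : 0 ∈ l) {p : ℤ × List ℕ} (hp : p ∈ headNormal l) :
    ∃ w, p.2 = 0 :: w ∧ (0 :: w).Perm l := by
  obtain ⟨u, v, rfl, h⟩ := List.eq_append_cons_of_mem hl
  rcases eq_or_ne u [] with rfl | hu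
  · simp only [List.nil_append, headNormal_zero_cons, List.mem_singleton] at hp
    exact ⟨v, by simp [hp], by simp⟩
  · rw [headNormal_append hu h, List.mem_map] at hp
    obtain ⟨q, hq, rfl⟩ := hp
    refine ⟨q.2 ++ v, rfl, ?_⟩
    exact (((perm_of_mem_expand hq).append_right v).cons 0).trans List.perm_middle.symm

end FormalSum

/-! ### Words in the generators of a free Lie algebra -/

section Words

variable {X : Type v}

/-- The span of the left-normed brackets of `n` generators of the free Lie algebra, that is, its
homogeneous component of degree `n`. -/
noncomputable def wordSpan (X : Type v) (n : ℕ) : Submodule ℂ (FreeLieAlgebra ℂ X) :=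
  Submodule.span ℂ {x | ∃ w : List X, w.length = n ∧
    leftNormed (w.map (FreeLieAlgebra.of ℂ)) = x}

theorem lie_leftNormed_mem_span {L : Type u} [LieRing L] [LieAlgebra ℂ L] (f : X → L)
    (w w' : List X) :
    ⁅leftNormed (w.map f), leftNormed (w'.map f)⁆ ∈
      Submodule.span ℂ (Set.range fun w : List X => leftNormed (w.map f)) := by
  induction w' using List.reverseRecOn generalizing w with
  | nil => simp [leftNormed]
  | append_singleton l a ih =>
    rcases eq_or_ne w [] with rfl | hw
    · simp [leftNormed]
    have hconcat : ∀ x ∈ Submodule.span ℂ (Set.range fun w : List X => leftNormed (w.map f)),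
        ⁅x, f a⁆ ∈ Submodule.span ℂ (Set.range fun w : List X => leftNormed (w.map f)) := by
      intro x hx
      induction hx using Submodule.span_induction with
      | mem x h =>
        obtain ⟨w, rfl⟩ := h
        rcases eq_or_ne w [] with rfl | hw
        · simp [leftNormed]
        · refine Submodule.subset_span ⟨w ++ [a], ?_⟩
          simp [leftNormed_concat (l := w.map f) (by simpa using hw)]
      | zero => simp
      | add x y _ _ hx hy => rw [add_lie]; exact add_mem hx hy
      | smul c x _ hx => rw [smul_lie]; exact Submodule.smul_mem _ c hx
    rcases eq_or_ne l [] with rfl | hl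
    · exact hconcat _ (Submodule.subset_span ⟨w, rfl⟩)
    · rw [List.map_append, List.map_singleton, leftNormed_concat (by simpa using hl), leibniz_lie,
        ← lie_skew _ ⁅leftNormed (w.map f), f a⁆]
      refine add_mem (hconcat _ (ih w)) (neg_mem ?_)
      have := ih (w ++ [a])
      rwa [List.map_append, List.map_singleton, leftNormed_concat (by simpa using hw)] at this

/-- The free Lie algebra is spanned by the left-normed brackets of generators. -/
theorem span_leftNormed_of_eq_top :
    Submodule.span ℂ (Set.range fun w : List X => leftNormed (w.map (FreeLieAlgebra.of ℂ))) =
      ⊤ := by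
  let A : LieSubalgebra ℂ (FreeLieAlgebra ℂ X) :=
    { Submodule.span ℂ (Set.range fun w : List X =>
        leftNormed (w.map (FreeLieAlgebra.of ℂ))) with
      lie_mem' := by
        intro x y hx hy
        change x ∈ Submodule.span ℂ _ at hx
        change y ∈ Submodule.span ℂ _ at hy
        change _ ∈ Submodule.span ℂ _
        induction hx using Submodule.span_induction with
        | zero => simp
        | add x y _ _ hx hy => rw [add_lie]; exact add_mem hx hy
        | smul c x _ hx => rw [smul_lie]; exact Submodule.smul_mem _ c hx
        | mem x h =>
          obtain ⟨w, rfl⟩ := h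
          induction hy using Submodule.span_induction with
          | zero => simp
          | add x y _ _ hx hy => rw [lie_add]; exact add_mem hx hy
          | smul c x _ hx => rw [lie_smul]; exact Submodule.smul_mem _ c hx
          | mem y h =>
            obtain ⟨w', rfl⟩ := h
            exact lie_leftNormed_mem_span _ w w' }
  have hof : ∀ x : X, FreeLieAlgebra.of ℂ x ∈ A := fun x =>
    Submodule.subset_span ⟨[x], by simp [leftNormed]⟩
  have hid : A.incl.comp (FreeLieAlgebra.lift ℂ fun x => (⟨_, hof x⟩ : A)) = LieHom.id := by
    ext x
    simp
  refine eq_top_iff.2 fun x _ => ?_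
  have h1 := LieHom.congr_fun hid x
  have h2 : ((FreeLieAlgebra.lift ℂ fun x => (⟨_, hof x⟩ : A)) x : FreeLieAlgebra ℂ X) ∈ A :=
    Subtype.property _
  have h3 : ((FreeLieAlgebra.lift ℂ fun x => (⟨_, hof x⟩ : A)) x : FreeLieAlgebra ℂ X) = x := h1
  rw [h3] at h2
  exact h2

theorem iSup_wordSpan : ⨆ n, wordSpan X n = ⊤ := by
  refine eq_top_iff.2 (span_leftNormed_of_eq_top.ge.trans (Submodule.span_le.2 ?_))
  rintro _ ⟨w, rfl⟩
  exact Submodule.mem_iSup_of_mem w.length (Submodule.subset_span ⟨w, rfl, rfl⟩)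

end Words

/-! ### Fully invariant subspaces of free Lie algebras -/

section FullyInvariant

variable {X : Type v}

/-- A subspace of a free Lie algebra that is stable under all substitutions, that is, under all
endomorphisms of the Lie algebra. -/
def IsFullyInvariant (I : Submodule ℂ (FreeLieAlgebra ℂ X)) : Prop :=
  ∀ ψ : FreeLieAlgebra ℂ X →ₗ⁅ℂ⁆ FreeLieAlgebra ℂ X, ∀ x ∈ I, ψ x ∈ I

/-- A substitution maps a word in the generators to the word in the values. -/
theorem lift_leftNormed {L : Type u} [LieRing L] [LieAlgebra ℂ L] (y : X → L) (w : List X) :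
    FreeLieAlgebra.lift ℂ y (leftNormed (w.map (FreeLieAlgebra.of ℂ))) = leftNormed (w.map y) := by
  rw [map_leftNormed, List.map_map]
  congr 2
  ext x
  simp

theorem leftNormed_map_smul {L : Type u} [LieRing L] [LieAlgebra ℂ L] (t : X → ℂ) (y : X → L)
    (w : List X) :
    leftNormed (w.map fun x => t x • y x) = (w.map t).prod • leftNormed (w.map y) := by
  induction w using List.reverseRecOn with
  | nil => simp [leftNormed]
  | append_singleton w a ih =>
    rcases eq_or_ne w [] with rfl | hw
    · simp [leftNormed]
    · rw [List.map_append, List.map_append, List.map_append, List.map_singleton,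
        List.map_singleton, List.map_singleton, leftNormed_concat (by simpa using hw),
        leftNormed_concat (by simpa using hw), ih, smul_lie, lie_smul, smul_smul,
        List.prod_append, List.prod_singleton]

/-- A fully invariant subspace contains the homogeneous components of its elements, hence it is
determined by its intersections with the homogeneous components of the free Lie algebra. -/
theorem IsFullyInvariant.le_of_forall_inf_wordSpan_le
    {I J : Submodule ℂ (FreeLieAlgebra ℂ X)} (hI : IsFullyInvariant I)
    (h : ∀ n, I ⊓ wordSpan X n ≤ J) : I ≤ J := by
  intro x hx
  obtain ⟨f, hf, rfl⟩ := (Submodule.mem_iSup_iff_exists_finsupp _ _).1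
    (iSup_wordSpan (X := X) ▸ Submodule.mem_top (x := x))
  -- the homogeneous components are eigenvectors of the dilation by `2`
  let δ := FreeLieAlgebra.lift ℂ fun i : X => (2 : ℂ) • FreeLieAlgebra.of ℂ i
  have hδ : ∀ n, ∀ y ∈ wordSpan X n, δ y = (2 : ℂ) ^ n • y := by
    intro n y hy
    induction hy using Submodule.span_induction with
    | mem y h =>
      obtain ⟨w, rfl, rfl⟩ := h
      rw [lift_leftNormed, leftNormed_map_smul fun _ => 2]
      simp
    | zero => simp
    | add y z _ _ hy hz => rw [map_add, hy, hz, smul_add]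
    | smul c y _ hy => rw [map_smul, hy, smul_comm]
  have key := mem_of_sum_eigenvectors_mem (δ : _ →ₗ[ℂ] FreeLieAlgebra ℂ X) I (hI δ)
    (fun n : ℕ => (2 : ℂ) ^ n) f.support
    (fun a _ b _ (hab : (2 : ℂ) ^ a = 2 ^ b) => Nat.pow_right_injective le_rfl (by exact_mod_cast hab))
    f (fun n _ => hδ n _ (hf n)) hx
  exact J.sum_mem fun n hn => h n ⟨key n hn, hf n⟩

end FullyInvariant

/-! ### Polarization -/

section Polarization

open Finset in
/-- Inclusion–exclusion over the subsets that contain the range of `g`. -/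
theorem sum_neg_one_pow_of_range_subset {n : ℕ} (g : Fin n → Fin n) :
    (∑ S : Finset (Fin n), if ∀ p, g p ∈ S then (-1 : ℂ) ^ #Sᶜ else 0) =
      if Function.Bijective g then 1 else 0 := by
  classical
  have h1 : ∏ j : Fin n, ((1 : ℂ) + if j ∈ Set.range g then 0 else -1) =
      if Function.Bijective g then 1 else 0 := by
    split_ifs with h
    · exact prod_eq_one fun j _ => by simp [h.surjective.range_eq]
    · obtain ⟨j, hj⟩ := not_forall.1 (mt Finite.surjective_iff_bijective.1 h)
      exact prod_eq_zero (mem_univ j) (by rw [if_neg (by simpa using hj)]; ring)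
  rw [← h1, prod_add, powerset_univ]
  refine sum_congr rfl fun S _ => ?_
  rw [prod_const_one, one_mul, ← compl_eq_univ_sdiff]
  split_ifs with h
  · rw [prod_congr rfl fun j hj => if_neg ?_, prod_const]
    rintro ⟨p, rfl⟩
    exact (mem_compl.1 hj) (h p)
  · obtain ⟨p, hp⟩ := not_forall.1 h
    exact (prod_eq_zero (mem_compl.2 hp) (by simp)).symm

/-- Left-normed brackets are multilinear. -/
theorem exists_multilinearMap_leftNormed (L : Type u) [LieRing L] [LieAlgebra ℂ L] (n : ℕ) :
    ∃ M : MultilinearMap ℂ (fun _ : Fin n => L) L, ∀ z, M z = leftNormed (List.ofFn z) := by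
  induction n with
  | zero => exact ⟨0, fun z => by simp [leftNormed]⟩
  | succ n ih =>
    obtain ⟨M, hM⟩ := ih
    rcases Nat.eq_zero_or_pos n with rfl | hn
    · exact ⟨MultilinearMap.ofSubsingleton ℂ L L (0 : Fin 1) LinearMap.id,
        fun z => by simp [leftNormed]⟩
    · refine ⟨((LieModule.toEnd ℂ L L : L →ₗ[ℂ] L →ₗ[ℂ] L).compMultilinearMap M).uncurryRight,
        fun z => ?_⟩
      rw [MultilinearMap.uncurryRight_apply, List.ofFn_succ', List.concat_eq_append,
        leftNormed_concat (by simp [List.ofFn_eq_nil_iff, hn.ne'])]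
      simp [hM]
      rfl

variable {X : Type v} [Fintype X]

/-- If a fully invariant subspace contains a homogeneous element, then it contains all values of
the components of its full polarization. -/
theorem IsFullyInvariant.polarization_mem {I : Submodule ℂ (FreeLieAlgebra ℂ X)}
    (hI : IsFullyInvariant I) {n : ℕ} (c : (Fin n → X) → ℂ)
    (hc : ∑ w, c w • leftNormed (List.ofFn fun p => FreeLieAlgebra.of ℂ (w p)) ∈ I)
    (u : Fin n → X) (z : Fin n → FreeLieAlgebra ℂ X) :
    ∑ σ : Equiv.Perm (Fin n), c (u ∘ σ) • leftNormed (List.ofFn (z ∘ σ)) ∈ I := by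
  classical
  obtain ⟨M, hM⟩ := exists_multilinearMap_leftNormed (FreeLieAlgebra ℂ X) n
  simp only [← hM] at hc ⊢
  -- Substitute for every generator `x` the sum of the `z j` with `j ∈ S` and `u j = x`.
  have key : ∀ S : Finset (Fin n),
      ∑ g : Fin n → Fin n, (if ∀ p, g p ∈ S then c (u ∘ g) • M (z ∘ g) else 0) ∈ I := by
    intro S
    let y : X → FreeLieAlgebra ℂ X := fun x => ∑ j with u j = x, if j ∈ S then z j else 0
    have hψ := hI (FreeLieAlgebra.lift ℂ y) _ hc
    have hval : ∀ w : Fin n → X, FreeLieAlgebra.lift ℂ y (M fun p => FreeLieAlgebra.of ℂ (w p)) =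
        ∑ g : Fin n → Fin n with u ∘ g = w, if ∀ p, g p ∈ S then M (z ∘ g) else 0 := by
      intro w
      rw [hM, map_leftNormed, List.map_ofFn]
      have : (⇑(FreeLieAlgebra.lift ℂ y) ∘ fun p => FreeLieAlgebra.of ℂ (w p)) =
          fun p => ∑ j ∈ Finset.univ.filter (fun j => u j = w p), if j ∈ S then z j else 0 := by
        ext p
        simp [y]
      rw [this, ← hM, M.map_sum_finset]
      refine Finset.sum_congr ?_ fun g _ => ?_
      · ext g
        simp [Fintype.mem_piFinset, funext_iff]
      · split_ifs with h
        · congr 1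
          ext p
          simp [h p]
        · obtain ⟨p, hp⟩ := not_forall.1 h
          exact M.map_coord_zero p (by simp [hp])
    rw [map_sum] at hψ
    simp only [map_smul, hval] at hψ
    convert hψ using 1
    rw [← Finset.sum_fiberwise (s := Finset.univ) (g := fun g => u ∘ g)]
    refine Finset.sum_congr rfl fun w _ => ?_
    rw [Finset.smul_sum]
    refine Finset.sum_congr rfl fun g hg => ?_
    rw [← (Finset.mem_filter.1 hg).2, smul_ite, smul_zero]
  have h1 := I.sum_mem fun S (_ : S ∈ Finset.univ) => I.smul_mem ((-1 : ℂ) ^ Finset.card Sᶜ) (key S)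
  convert h1 using 1
  simp only [Finset.smul_sum]
  rw [Finset.sum_comm]
  have h2 : ∀ g : Fin n → Fin n, ∑ S : Finset (Fin n), ((-1 : ℂ) ^ Finset.card Sᶜ •
      if ∀ p, g p ∈ S then c (u ∘ g) • M (z ∘ g) else 0) =
      if Function.Bijective g then c (u ∘ g) • M (z ∘ g) else 0 := by
    intro g
    have := congrArg (fun t : ℂ => t • c (u ∘ g) • M (z ∘ g)) (sum_neg_one_pow_of_range_subset g)
    simpa only [Finset.sum_smul, ite_smul, zero_smul, one_smul, smul_ite, smul_zero] using this
  simp only [h2]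
  rw [← Finset.sum_filter]
  refine Finset.sum_bij (fun σ _ => ⇑σ) (fun σ _ => Finset.mem_filter.2 ⟨Finset.mem_univ _, σ.bijective⟩)
    (fun σ _ τ _ h => DFunLike.coe_injective h)
    (fun g hg => ⟨Equiv.ofBijective g (by simpa using hg), by simp, by ext; simp⟩)
    (fun σ _ => rfl)

/-- A homogeneous element is recovered from the components of its full polarization. -/
theorem sum_polarization_eq {L : Type u} [LieRing L] [LieAlgebra ℂ L] {n : ℕ}
    (c : (Fin n → X) → ℂ) (y : X → L) :
    ∑ u : Fin n → X, ∑ σ : Equiv.Perm (Fin n),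
        c (u ∘ σ) • leftNormed (List.ofFn ((y ∘ u) ∘ σ)) =
      (n.factorial : ℂ) • ∑ w, c w • leftNormed (List.ofFn fun p => y (w p)) := by
  rw [Finset.sum_comm]
  have : ∀ σ : Equiv.Perm (Fin n), ∑ u : Fin n → X,
      c (u ∘ σ) • leftNormed (List.ofFn ((y ∘ u) ∘ σ)) =
        ∑ w, c w • leftNormed (List.ofFn fun p => y (w p)) := fun σ =>
    Fintype.sum_equiv (σ.symm.arrowCongr (Equiv.refl X)) _ _ fun u => rfl
  simp only [this, Finset.sum_const, Finset.card_univ, Fintype.card_perm, Fintype.card_fin]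
  rw [← Nat.cast_smul_eq_nsmul ℂ]

/-- The elements of the homogeneous component of degree `n` as sums over words. -/
theorem exists_eq_sum_of_mem_wordSpan {n : ℕ} {f : FreeLieAlgebra ℂ X} (hf : f ∈ wordSpan X n) :
    ∃ c : (Fin n → X) → ℂ,
      f = ∑ w, c w • leftNormed (List.ofFn fun p => FreeLieAlgebra.of ℂ (w p)) := by
  have : {x | ∃ w : List X, w.length = n ∧ leftNormed (w.map (FreeLieAlgebra.of ℂ)) = x} =
      Set.range fun w : Fin n → X =>
        leftNormed (List.ofFn fun p => FreeLieAlgebra.of ℂ (w p)) := by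
    ext x
    constructor
    · rintro ⟨w, rfl, rfl⟩
      exact ⟨w.get, by simp⟩
    · rintro ⟨w, rfl⟩
      exact ⟨List.ofFn w, by simp, by simp [List.map_ofFn, Function.comp_def]⟩
  rw [wordSpan, this, Submodule.mem_span_range_iff_exists_fun] at hf
  obtain ⟨c, hc⟩ := hf
  exact ⟨c, hc.symm⟩

end Polarization

/-! ### Identities as coefficient vectors -/

section CoeffSpace

variable {L : Type u} [LieRing L] [LieAlgebra ℂ L]

/-- The linear combinations of the given words all of whose values lie in `I`, as vectors of
coefficients. -/
def coeffSpace (W : List (List ℕ)) (I : Submodule ℂ L) : Submodule ℂ (Fin W.length → ℂ) where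
  carrier := {c | ∀ z : ℕ → L, ∑ i, c i • leftNormed ((W.get i).map z) ∈ I}
  add_mem' ha hb z := by
    simp only [Pi.add_apply, add_smul, Finset.sum_add_distrib]
    exact add_mem (ha z) (hb z)
  zero_mem' z := by simp
  smul_mem' t c hc z := by
    simp only [Pi.smul_apply, smul_assoc, ← Finset.smul_sum]
    exact I.smul_mem t (hc z)

/-- The matrix of an operator on words, where the values of the operator are combinations of the
given words. -/
def opMatrix (W : List (List ℕ)) (op : List ℕ → FormalSum) :
    Matrix (Fin W.length) (Fin W.length) ℤ :=
  Matrix.of fun i k => (op (W.get i)).coeff (W.get k)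

open FormalSum in
/-- The operator acts on vectors of coefficients through its matrix. -/
theorem sum_smul_eval_eq {W : List (List ℕ)} (hW : W.Nodup) {op : List ℕ → FormalSum}
    (hop : ∀ w ∈ W, ∀ p ∈ op w, p.2 ∈ W) (c : Fin W.length → ℂ) (z : ℕ → L) :
    ∑ i, Matrix.vecMul c ((opMatrix W op).map (Int.castRingHom ℂ)) i •
      leftNormed ((W.get i).map z) = ∑ i, c i • eval z (op (W.get i)) := by
  have h : ∀ i, eval z (op (W.get i)) =
      ∑ k, (opMatrix W op i k : ℂ) • leftNormed ((W.get k).map z) := by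
    intro i
    rw [eval_eq_sum_coeff z _ W.get (List.nodup_iff_injective_get.1 hW)
      fun p hp => List.mem_iff_get.1 (hop _ (List.get_mem W i) p hp)]
    simp [opMatrix, Int.cast_smul_eq_zsmul]
  simp only [h, Matrix.vecMul, dotProduct, Finset.sum_smul, Finset.smul_sum, smul_smul]
  rw [Finset.sum_comm]
  simp

/-- In the Lie algebra `L`, every word in `S` is a linear combination of words in the list `W`, as a
function of the values of the letters. -/
def SpansWords (L : Type u) [LieRing L] [LieAlgebra ℂ L] (W : List (List ℕ))
    (S : Set (List ℕ)) : Prop :=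
  ∀ w ∈ S, (fun z : ℕ → L => leftNormed (w.map z)) ∈ Submodule.span ℂ
    (Set.range fun (i : Fin W.length) (z : ℕ → L) => leftNormed ((W.get i).map z))

/-- If `I'` satisfies all identities of `I` in the words of `W`, then also all identities in the
words that are spanned by them. -/
theorem SpansWords.sum_mem {W : List (List ℕ)} {S : Set (List ℕ)} (h : SpansWords L W S)
    {I I' : Submodule ℂ L} (hle : coeffSpace W I ≤ coeffSpace W I') {ι : Type*} [Fintype ι]
    (c : ι → ℂ) (w : ι → List ℕ) (hw : ∀ i, w i ∈ S)
    (hc : ∀ z : ℕ → L, ∑ i, c i • leftNormed ((w i).map z) ∈ I) (z : ℕ → L) :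
    ∑ i, c i • leftNormed ((w i).map z) ∈ I' := by
  have hmem : (∑ i, c i • fun z : ℕ → L => leftNormed ((w i).map z)) ∈ Submodule.span ℂ
      (Set.range fun (i : Fin W.length) (z : ℕ → L) => leftNormed ((W.get i).map z)) :=
    Submodule.sum_mem _ fun i _ => Submodule.smul_mem _ _ (h _ (hw i))
  obtain ⟨a, ha⟩ := (Submodule.mem_span_range_iff_exists_fun ℂ).1 hmem
  have ha' : ∀ z : ℕ → L, ∑ i, a i • leftNormed ((W.get i).map z) =
      ∑ i, c i • leftNormed ((w i).map z) := fun z => by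
    simpa [Finset.sum_apply] using congrFun ha z
  rw [← ha']
  exact hle (fun z => by rw [ha']; exact hc z) z

end CoeffSpace

/-! ### Finiteness from a simple spectrum -/

theorem Set.Finite.image_of_factor {α β γ : Type*} {S : Set α} {f : α → β} {g : α → γ}
    (hf : (f '' S).Finite) (h : ∀ a ∈ S, ∀ b ∈ S, f a = f b → g a = g b) : (g '' S).Finite := by
  rcases S.eq_empty_or_nonempty with rfl | ⟨a₀, -⟩
  · simp
  have : Nonempty α := ⟨a₀⟩
  refine Set.Finite.of_surjOn (fun y => g (Function.invFunOn f S y)) ?_ hf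
  rintro _ ⟨a, ha, rfl⟩
  have hex : ∃ b ∈ S, f b = f a := ⟨a, ha, rfl⟩
  exact ⟨f a, ⟨a, ha, rfl⟩, h _ (Function.invFunOn_mem hex) _ ha (Function.invFunOn_eq hex)⟩

/-- The integer matrix `M` has the eigenvalues and left eigenvectors that are listed in the table,
and the eigenvalues are distinct. -/
def IsSpectralTable {d : ℕ} (M : Matrix (Fin d) (Fin d) ℤ) (t : List (ℤ × List ℤ)) : Prop :=
  t.length = d ∧ (t.map Prod.fst).Nodup ∧ (∀ r ∈ t, r.2.length = d ∧ ∃ x ∈ r.2, x ≠ 0) ∧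
    ∀ r ∈ t, ∀ k : Fin d, ∑ i : Fin d, r.2.getD i 0 * M i k = r.1 * r.2.getD k 0

theorem IsSpectralTable.finite_invariant {d : ℕ} {M : Matrix (Fin d) (Fin d) ℤ}
    {t : List (ℤ × List ℤ)} (h : IsSpectralTable M t) :
    {N : Submodule ℂ (Fin d → ℂ) |
      ∀ c ∈ N, Matrix.vecMul c (M.map (Int.castRingHom ℂ)) ∈ N}.Finite := by
  obtain ⟨rfl, h2, h3, h4⟩ := h
  refine finite_invariant_of_simple_spectrum _ (fun j => ((t.get j).1 : ℂ)) ?_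
    (fun j i => ((t.get j).2.getD i 0 : ℤ)) (fun j hj => ?_) (fun j => ?_)
  · intro i j hij
    have hij' : (t.get i).1 = (t.get j).1 := Int.cast_injective (α := ℂ) hij
    have hlen : ∀ i : Fin t.length, (i : ℕ) < (t.map Prod.fst).length := by simp
    have := (List.nodup_iff_injective_get.1 h2)
      (a₁ := ⟨i, hlen i⟩) (a₂ := ⟨j, hlen j⟩) (by simpa using hij')
    exact Fin.ext (by simpa using this)
  · obtain ⟨hl, x, hx, hx0⟩ := h3 _ (List.get_mem t j)
    obtain ⟨i, hi, rfl⟩ := List.mem_iff_getElem.1 hx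
    have := congrFun hj ⟨i, hl ▸ hi⟩
    simp only [Pi.zero_apply, Int.cast_eq_zero] at this
    rw [List.getD_eq_getElem _ _ hi] at this
    exact hx0 this
  · ext k
    have := congrArg (Int.cast : ℤ → ℂ) (h4 _ (List.get_mem t j) k)
    simpa [Matrix.vecMul, dotProduct] using this

/-- The finiteness criterion: the list `W` of words carries an operator that preserves identities
and has a simple spectrum, and the homogeneous elements of degree `n` of a fully invariant subspace
are determined by its identities in the words of `W`. -/
theorem finite_inf_wordSpan {X : Type v} {n : ℕ} {W : List (List ℕ)} (hW : W.Nodup)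
    {op : List ℕ → FormalSum} (hop : ∀ w ∈ W, ∀ p ∈ op w, p.2 ∈ W) {t : List (ℤ × List ℤ)}
    (ht : IsSpectralTable (opMatrix W op) t)
    (hstable : ∀ I : Submodule ℂ (FreeLieAlgebra ℂ X), IsFullyInvariant I → ∀ c ∈ coeffSpace W I,
      ∀ z, ∑ i, c i • FormalSum.eval z (op (W.get i)) ∈ I)
    (hdet : ∀ I I' : Submodule ℂ (FreeLieAlgebra ℂ X), IsFullyInvariant I → IsFullyInvariant I' →
      coeffSpace W I ≤ coeffSpace W I' → I ⊓ wordSpan X n ≤ I') :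
    ((fun I => I ⊓ wordSpan X n) '' {I | IsFullyInvariant I}).Finite := by
  refine Set.Finite.image_of_factor (f := coeffSpace W) (ht.finite_invariant.subset ?_) ?_
  · rintro _ ⟨I, hI, rfl⟩ c hc z
    rw [sum_smul_eval_eq hW hop]
    exact hstable I hI c hc z
  · intro I hI I' hI' h
    exact le_antisymm (le_inf (hdet I I' hI hI' h.le) inf_le_right)
      (le_inf (hdet I' I hI' hI h.ge) inf_le_right)

/-! ### Multilinear words in at most five letters -/

namespace FormalSum

/-- The multilinear words in the letters `0, …, n - 1` that start with the letter `0`. -/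
def headWords (n : ℕ) : List (List ℕ) :=
  (List.range' 1 (n - 1)).permutations'.map fun l => 0 :: l

/-- The transposition of two letters. -/
def swapLetter (i j x : ℕ) : ℕ := bif x == i then j else bif x == j then i else x

/-- The action of a linear combination of the Jucys–Murphy elements of the symmetric group on
multilinear words. The coefficients are powers of `7` in order that its eigenvalues, which are
combinations of contents of boxes of standard Young tableaux, separate the tableaux. -/
def jucysMurphy (n : ℕ) (w : List ℕ) : FormalSum :=
  (List.range n).flatMap fun j => (List.range j).flatMap fun i =>
    scale (7 ^ (j - 1)) (headNormal (w.map (swapLetter i j)))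

/-- The eigenvalues of `jucysMurphy n` and its eigenvectors, in the order of `headWords n`. -/
def jucysMurphyTable : ℕ → List (ℤ × List ℤ)
  | 1 => [
      (0, [1])]
  | 2 => [
      (-1, [1])]
  | 3 => [
      (-6, [-1, 2]),
      (6, [1, 0])]
  | 4 => [
      (-104, [0, 1, -1, 0, -1, 1]),
      (-92, [-2, -1, 1, 2, -1, 1]),
      (-34, [1, 1, -3, -3, 3, 3]),
      (34, [1, -1, 1, -1, -1, 1]),
      (92, [4, -5, -3, 0, -3, 3]),
      (104, [2, -1, 1, 2, -1, 1])]
  | 5 => [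
      (-1133, [-1, 3, -1, 0, 1, -3, 1, 0, -1, 3, -1, 0, 1, -3, 1, 0, -1, 3, -1, 0, 1, -3, 1, 0]),
      (-1121, [5, 1, 1, -2, -1, -1, -5, 6, -1, 3, -1, -2, -5, -1, -1, 2, 1, 1, 5, -6, 1, -3, 1, 2]),
      (-995, [-1, 1, 7, -8, -7, -1, 1, 0, 8, 0, 2, -2, 4, -4, 2, 2, -2, 4, -4, 0, -2, 0, -8, 8]),
      (-720, [0, 0, -1, 1, -1, 1, 1, 0, 1, 0, -1, -1, 0, 0, 1, -1, 1, -1, -1, 0, -1, 0, 1, 1]),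
      (-692, [-1, 1, 0, 1, -1, 1, 0, 1, 1, -2, 2, -2, 1, -2, 2, -2, 0, 1, -2, 1, 0, 1, -2, 1]),
      (-680, [-1, 1, 2, -3, 1, -1, -2, 3, -3, 0, 2, -2, 3, 0, -2, 2, -4, 3, 0, -3, 4, -3, 0, 3]),
      (-594, [-3, 3, 2, 1, -1, 1, -2, 3, 1, 0, 2, -4, 3, 0, -2, -4, -2, -1, 2, 3, 2, -3, -2, 1]),
      (-582, [-1, 1, 0, -1, -1, 1, 0, -1, -1, -2, 2, 0, -1, -2, 2, 0, 2, -1, 0, 1, 2, -1, 0, 1]),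
      (-181, [-1, -1, -1, 4, -1, -1, -1, 4, 4, 4, -6, -6, 4, 4, -6, -6, -6, 4, 4, 4, -6, 4, 4, 4]),
      (-104, [-1, 3, -4, 3, 1, -3, 4, -3, -1, 0, 2, 0, 1, 0, -2, 0, 2, -3, 2, -3, -2, 3, -2, 3]),
      (-92, [-5, -1, 2, -1, 7, -5, 2, 3, -5, 6, -2, -4, -1, -2, -2, 4, 2, -1, 4, -3, 2, 3, -4, 1]),
      (-34, [0, 0, -1, 1, -1, 3, 3, -4, 1, -4, 1, 1, 0, 0, -1, 1, -1, 3, 3, -4, 1, -4, 1, 1]),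
      (34, [-2, 2, -1, -1, 1, 1, -1, 0, 1, 0, 1, -1, 2, -2, 1, 1, -1, -1, 1, 0, -1, 0, -1, 1]),
      (92, [3, -9, -8, 11, 1, -3, 0, 1, -1, 4, 2, -4, -3, 12, -2, -4, -2, 9, -6, 1, 2, -5, -10, 11]),
      (104, [5, 1, 2, -3, 5, 1, 2, -3, -7, -2, 2, 0, -7, -2, 2, 0, 2, 1, -4, 3, 2, 1, -4, 3]),
      (181, [1, -1, 1, 0, -1, 1, -1, 0, 0, 0, -2, 2, 0, 0, 2, -2, -2, 0, 0, 0, 2, 0, 0, 0]),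
      (582, [-3, -1, 2, 5, 3, 1, -2, -5, -3, 4, 2, 0, 3, -4, -2, 0, 2, -1, 2, -5, -2, 1, -2, 5]),
      (594, [-5, -7, 8, -1, 7, -3, 0, 3, 7, -6, 2, 4, -5, 2, 2, -4, -2, 3, 0, -3, -2, -9, 8, 1]),
      (680, [-1, 5, -4, 1, -1, 5, -4, 1, 1, -2, -6, 6, 1, -2, -6, 6, 0, 1, -2, 1, 0, 1, -2, 1]),
      (692, [-3, -1, 2, -1, 3, 1, -2, 1, -1, 0, -2, 2, 1, 0, 2, -2, 4, 1, 0, -1, -4, -1, 0, 1]),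
      (720, [-2, 2, -1, -1, 1, 3, -3, 0, 1, 0, -1, 1, -2, 2, -1, -1, 1, 3, -3, 0, 1, 0, -1, 1]),
      (995, [-3, -3, 5, 4, 5, -3, -3, -4, 4, -4, -2, -2, 0, 0, 2, -2, 2, 0, 0, -4, -2, -4, 4, 4]),
      (1121, [-3, 3, 1, 2, 1, 3, -3, -2, -1, 1, -1, 2, -3, 3, 1, 2, 1, 3, -3, -2, -1, 1, -1, 2]),
      (1133, [1, -1, 1, 0, 1, -1, 1, 0, 1, -1, 1, 0, 1, -1, 1, 0, 1, -1, 1, 0, 1, -1, 1, 0])]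
  | _ => []

theorem isSpectralTable_jucysMurphy {n : ℕ} (hn : 1 ≤ n) (hn' : n ≤ 5) :
    IsSpectralTable (opMatrix (headWords n) (jucysMurphy n)) (jucysMurphyTable n) := by
  unfold IsSpectralTable
  interval_cases n
  · decide +kernel
  · decide +kernel
  · decide +kernel
  · decide +kernel
  · decide +kernel

end FormalSum

namespace FormalSum

theorem mem_headWords {n : ℕ} (hn : 1 ≤ n) {w : List ℕ} :
    w ∈ headWords n ↔ w.Perm (List.range n) ∧ ∃ l, w = 0 :: l := by
  obtain ⟨n, rfl⟩ := Nat.exists_eq_add_of_le' hn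
  rw [List.range_eq_range', List.range'_succ]
  simp only [headWords, List.mem_map, List.mem_permutations', Nat.add_sub_cancel, Nat.zero_add]
  constructor
  · rintro ⟨l, hl, rfl⟩
    exact ⟨hl.cons 0, l, rfl⟩
  · rintro ⟨hl, l, rfl⟩
    exact ⟨l, (List.perm_cons 0).1 hl, rfl⟩

theorem nodup_headWords (n : ℕ) : (headWords n).Nodup :=
  ((List.permutations_perm_permutations' _).nodup
    (List.nodup_permutations _ List.nodup_range')).map List.cons_injective

theorem map_swapLetter_perm {n i j : ℕ} (hi : i < n) (hj : j < n) {w : List ℕ}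
    (hw : w.Perm (List.range n)) : (w.map (swapLetter i j)).Perm (List.range n) := by
  have hs : swapLetter i j = Equiv.swap i j := by
    ext x
    simp [swapLetter, Equiv.swap_apply_def, Bool.cond_eq_ite]
  rw [hs]
  refine (hw.map _).trans ((List.perm_ext_iff_of_nodup
    (List.nodup_range.map (Equiv.swap i j).injective) List.nodup_range).2 fun a => ?_)
  simp only [List.mem_map, List.mem_range]
  have hlt : ∀ b < n, Equiv.swap i j b < n := fun b hb => by
    rw [Equiv.swap_apply_def]
    split_ifs <;> assumption
  exact ⟨fun ⟨b, hb, h⟩ => h ▸ hlt b hb, fun ha => ⟨Equiv.swap i j a, hlt a ha, by simp⟩⟩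

theorem zero_mem_of_perm_range {n : ℕ} (hn : 1 ≤ n) {w : List ℕ} (hw : w.Perm (List.range n)) :
    0 ∈ w := by
  rw [hw.mem_iff, List.mem_range]
  exact hn

/-- Normalized multilinear words are again multilinear words that start with the letter `0`. -/
theorem mem_headWords_of_mem_headNormal {n : ℕ} (hn : 1 ≤ n) {w : List ℕ}
    (hw : w.Perm (List.range n)) {p : ℤ × List ℕ} (hp : p ∈ headNormal w) :
    p.2 ∈ headWords n := by
  obtain ⟨l, h1, h2⟩ := mem_headNormal (zero_mem_of_perm_range hn hw) hp
  exact (mem_headWords hn).2 ⟨h1 ▸ h2.trans hw, l, h1⟩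

theorem mem_headWords_of_mem_jucysMurphy {n : ℕ} (hn : 1 ≤ n) {w : List ℕ} (hw : w ∈ headWords n)
    {p : ℤ × List ℕ} (hp : p ∈ jucysMurphy n w) : p.2 ∈ headWords n := by
  simp only [jucysMurphy, List.mem_flatMap, List.mem_range, scale, List.mem_map] at hp
  obtain ⟨j, hj, i, hi, q, hq, rfl⟩ := hp
  exact mem_headWords_of_mem_headNormal (p := q) hn
    (map_swapLetter_perm (hi.trans hj) hj ((mem_headWords hn).1 hw).1) hq

section

variable {L : Type u} [LieRing L]

theorem eval_flatMap_range (z : ℕ → L) (n : ℕ) (f : ℕ → FormalSum) :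
    eval z ((List.range n).flatMap f) = ∑ j ∈ Finset.range n, eval z (f j) := by
  induction n with
  | zero => simp
  | succ n ih =>
    rw [List.range_succ, List.flatMap_append, eval_append, ih, Finset.sum_range_succ]
    simp

variable [LieAlgebra ℂ L]

theorem eval_jucysMurphy {n : ℕ} (hn : 1 ≤ n) {w : List ℕ} (hw : w ∈ headWords n) (z : ℕ → L) :
    eval z (jucysMurphy n w) = ∑ j ∈ Finset.range n, ∑ i ∈ Finset.range j,
      (7 ^ (j - 1) : ℂ) • leftNormed (w.map fun x => z (swapLetter i j x)) := by
  rw [jucysMurphy, eval_flatMap_range]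
  refine Finset.sum_congr rfl fun j hj => ?_
  rw [eval_flatMap_range]
  refine Finset.sum_congr rfl fun i hi => ?_
  rw [Finset.mem_range] at hi hj
  rw [eval_scale, eval_headNormal z (zero_mem_of_perm_range hn
    (map_swapLetter_perm (hi.trans hj) hj ((mem_headWords hn).1 hw).1)), List.map_map,
    ← Int.cast_smul_eq_zsmul ℂ]
  simp [Function.comp_def]

/-- Renaming the letters maps multilinear identities to multilinear identities. -/
theorem sum_smul_eval_jucysMurphy_mem {n : ℕ} (hn : 1 ≤ n) (I : Submodule ℂ L)
    {c : Fin (headWords n).length → ℂ} (hc : c ∈ coeffSpace (headWords n) I) (z : ℕ → L) :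
    ∑ i, c i • eval z (jucysMurphy n ((headWords n).get i)) ∈ I := by
  have h : ∑ i, c i • eval z (jucysMurphy n ((headWords n).get i)) =
      ∑ j ∈ Finset.range n, ∑ i ∈ Finset.range j, (7 ^ (j - 1) : ℂ) • ∑ k, c k •
        leftNormed (((headWords n).get k).map fun x => z (swapLetter i j x)) := by
    simp only [eval_jucysMurphy hn (List.get_mem _ _), Finset.smul_sum]
    rw [Finset.sum_comm]
    refine Finset.sum_congr rfl fun j _ => ?_
    rw [Finset.sum_comm]
    refine Finset.sum_congr rfl fun i _ => Finset.sum_congr rfl fun k _ => smul_comm _ _ _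
  rw [h]
  exact I.sum_mem fun j _ => I.sum_mem fun i _ => I.smul_mem _ (hc _)

/-- By the Jacobi identity, the multilinear words are spanned by those that start with the letter
`0`. -/
theorem spansWords_headWords {n : ℕ} (hn : 1 ≤ n) :
    SpansWords L (headWords n) {w | w.Perm (List.range n)} := by
  intro w hw
  rw [Submodule.mem_span_range_iff_exists_fun]
  refine ⟨fun i => ((headNormal w).coeff ((headWords n).get i) : ℂ), ?_⟩
  ext z
  rw [← eval_headNormal z (zero_mem_of_perm_range hn hw), eval_eq_sum_coeff z _ (headWords n).get
    (List.nodup_iff_injective_get.1 (nodup_headWords n))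
    fun p hp => List.mem_iff_get.1 (mem_headWords_of_mem_headNormal hn hw hp)]
  simp [Finset.sum_apply, Int.cast_smul_eq_zsmul]

end

end FormalSum

open FormalSum in
/-- In degree at most `5` there are only finitely many homogeneous components of fully invariant
subspaces. -/
theorem finite_inf_wordSpan_of_le_five (X : Type v) [Finite X] {n : ℕ} (hn : n ≤ 5) :
    ((fun I => I ⊓ wordSpan X n) '' {I | IsFullyInvariant I}).Finite := by
  cases nonempty_fintype X
  rcases Nat.eq_zero_or_pos n with rfl | hn0
  · have : wordSpan X 0 = ⊥ := by
      rw [wordSpan, Submodule.span_eq_bot]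
      rintro _ ⟨w, hw, rfl⟩
      rw [List.length_eq_zero_iff.1 hw]
      rfl
    refine (Set.finite_singleton ⊥).subset ?_
    rintro _ ⟨I, -, rfl⟩
    simp [this]
  refine finite_inf_wordSpan (nodup_headWords n)
    (fun w hw p hp => mem_headWords_of_mem_jucysMurphy hn0 hw hp)
    (isSpectralTable_jucysMurphy hn0 hn)
    (fun I _ c hc z => sum_smul_eval_jucysMurphy_mem hn0 I hc z) ?_
  rintro I I' hI hI' hle f ⟨hfI, hf⟩
  obtain ⟨c, rfl⟩ := exists_eq_sum_of_mem_wordSpan hf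
  have key : ∀ (u : Fin n → X) (z : ℕ → FreeLieAlgebra ℂ X), ∑ σ : Equiv.Perm (Fin n),
      c (u ∘ σ) • leftNormed ((List.ofFn fun i => (σ i : ℕ)).map z) ∈ I' := by
    intro u
    refine (spansWords_headWords hn0).sum_mem hle _ _ (fun σ => ?_) fun z => ?_
    · have h := (Equiv.Perm.map_finRange_perm σ).map Fin.val
      rw [List.map_coe_finRange_eq_range, List.map_map] at h
      simpa [List.ofFn_eq_map, Function.comp_def] using h
    · have := hI.polarization_mem c hfI u (fun i => z i)
      simpa [List.map_ofFn, Function.comp_def] using this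
  have h1 := sum_polarization_eq c (FreeLieAlgebra.of ℂ)
  have h2 : (n.factorial : ℂ) • ∑ w, c w •
      leftNormed (List.ofFn fun p => FreeLieAlgebra.of ℂ (w p)) ∈ I' := by
    rw [← h1]
    refine I'.sum_mem fun u _ => ?_
    have := key u fun i => if h : i < n then FreeLieAlgebra.of ℂ (u ⟨i, h⟩) else 0
    simpa [List.map_ofFn, Function.comp_def] using this
  have hne : (n.factorial : ℂ) ≠ 0 := by exact_mod_cast n.factorial_ne_zero
  simpa [smul_smul, hne] using I'.smul_mem (n.factorial : ℂ)⁻¹ h2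

/-! ### Words of length six in two letters -/

namespace FormalSum

/-- A list of words of length `6` whose values form a basis of the homogeneous component of
degree `6` of the free Lie algebra on two generators. -/
def binaryBasis : List (List ℕ) :=
  [[0, 1, 0, 0, 0, 0], [0, 1, 0, 0, 1, 0], [0, 1, 0, 0, 0, 1], [0, 1, 0, 1, 0, 1],
    [0, 1, 0, 0, 1, 1], [0, 1, 1, 0, 1, 0], [0, 1, 1, 1, 0, 1], [0, 1, 1, 1, 1, 0],
    [0, 1, 1, 1, 1, 1]]

/-- The combination of words in `binaryBasis` that has the same value as a word of length `6` in
the letters `0` and `1` that starts with `0, 1`. -/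
def binaryReduce : List ℕ → FormalSum
  | [0, 1, 0, 1, 0, 0] => [(2, [0, 1, 0, 0, 1, 0]), (-1, [0, 1, 0, 0, 0, 1])]
  | [0, 1, 1, 0, 0, 0] => [(2, [0, 1, 0, 0, 1, 0]), (-1, [0, 1, 0, 0, 0, 1])]
  | [0, 1, 1, 0, 0, 1] => [(1, [0, 1, 0, 1, 0, 1])]
  | [0, 1, 0, 1, 1, 0] => [(1, [0, 1, 1, 0, 1, 0])]
  | [0, 1, 1, 1, 0, 0] =>
    [(1, [0, 1, 0, 0, 1, 1]), (3, [0, 1, 1, 0, 1, 0]), (-3, [0, 1, 0, 1, 0, 1])]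
  | [0, 1, 1, 0, 1, 1] => [(2, [0, 1, 1, 1, 0, 1]), (-1, [0, 1, 1, 1, 1, 0])]
  | [0, 1, 0, 1, 1, 1] => [(2, [0, 1, 1, 1, 0, 1]), (-1, [0, 1, 1, 1, 1, 0])]
  | w => [(1, w)]

/-- The combination of words in `binaryBasis` that has the same value as a word of length `6` in
the letters `0` and `1`. -/
def binaryNormal : List ℕ → FormalSum
  | 0 :: 1 :: w => binaryReduce (0 :: 1 :: w)
  | 1 :: 0 :: w => scale (-1) (binaryReduce (0 :: 1 :: w))
  | _ => []

/-- The words of length `6` in the letters `0` and `1`. -/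
def IsBinary (w : List ℕ) : Prop := w.length = 6 ∧ ∀ x ∈ w, x < 2

instance (w : List ℕ) : Decidable (IsBinary w) := by unfold IsBinary; infer_instance

section

variable {L : Type u} [LieRing L] [LieAlgebra ℂ L]

theorem eval_binaryReduce (z : ℕ → L) {w : List ℕ} (hw : IsBinary (0 :: 1 :: w)) :
    eval z (binaryReduce (0 :: 1 :: w)) = leftNormed ((0 :: 1 :: w).map z) := by
  have rel := fun u v hu hv => eval_antisymm z (u := u) (v := v) hu hv
  -- antisymmetry of the brackets of words of lengths `2 + 4` and `3 + 3` gives all linear relations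
  -- between the words that start with `0, 1`
  have r1 := rel [0, 1] [0, 1, 0, 0] (by simp) (by simp)
  have r2 := rel [0, 1, 0] [0, 1, 0] (by simp) (by simp)
  have r3 := rel [0, 1] [0, 1, 0, 1] (by simp) (by simp)
  have r4 := rel [0, 1] [0, 1, 1, 0] (by simp) (by simp)
  have r5 := rel [0, 1, 0] [0, 1, 1] (by simp) (by simp)
  have r6 := rel [0, 1] [0, 1, 1, 1] (by simp) (by simp)
  have r7 := rel [0, 1, 1] [0, 1, 1] (by simp) (by simp)
  simp only [expand, expandStep, List.foldl_cons, List.foldl_nil, List.map_cons, List.map_nil,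
    List.cons_append, List.nil_append, eval_cons, eval_nil, one_mul] at r1 r2 r3 r4 r5 r6 r7
  obtain ⟨hl, hx⟩ := hw
  obtain ⟨a, b, c, d, rfl⟩ : ∃ a b c d, w = [a, b, c, d] := by
    match w, hl with
    | [a, b, c, d], _ => exact ⟨a, b, c, d, rfl⟩
  have ha : a < 2 := hx _ (by simp)
  have hb : b < 2 := hx _ (by simp)
  have hc : c < 2 := hx _ (by simp)
  have hd : d < 2 := hx _ (by simp)
  clear rel hl hx
  interval_cases a <;> interval_cases b <;> interval_cases c <;> interval_cases d <;>
    simp only [binaryReduce, eval_cons, eval_nil, List.map_cons, List.map_nil, one_smul, add_zero]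
  · linear_combination (norm := module) (1 / 2 : ℂ) • r2
  · linear_combination (norm := module) (-1 : ℂ) • r4 - r5
  · linear_combination (norm := module) (-1 : ℂ) • r6 - (3 / 2 : ℂ) • r7
  · linear_combination (norm := module) r1 + (3 / 2 : ℂ) • r2
  · linear_combination (norm := module) r3 + r5
  · linear_combination (norm := module) (-1 / 2 : ℂ) • r7
  · linear_combination (norm := module) (-1 : ℂ) • r3 - r4 - r5

theorem eval_binaryNormal (z : ℕ → L) {w : List ℕ} (hw : IsBinary w) :
    eval z (binaryNormal w) = leftNormed (w.map z) := by
  obtain ⟨hl, hx⟩ := hw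
  obtain ⟨a, b, w, rfl⟩ : ∃ a b v, w = a :: b :: v := by
    match w, hl with
    | a :: b :: v, _ => exact ⟨a, b, v, rfl⟩
  have h01 : IsBinary (0 :: 1 :: w) := ⟨by simpa using hl, by simp at hx ⊢; exact hx.2.2⟩
  have ha : a < 2 := hx _ (by simp)
  have hb : b < 2 := hx _ (by simp)
  interval_cases a <;> interval_cases b
  · simp [binaryNormal, leftNormed_cons, adTail_cons]
  · exact eval_binaryReduce z h01
  · rw [binaryNormal, eval_scale, eval_binaryReduce z h01]
    simp only [List.map_cons, leftNormed_cons, adTail_cons]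
    rw [← lie_skew (z 1), map_neg, neg_smul, one_smul]
  · simp [binaryNormal, leftNormed_cons, adTail_cons]

end

/-- All ways to replace some of the letters `a` of a word by the letter `b`, together with the
number of the replaced letters. -/
def replacements (a b : ℕ) : List ℕ → List (ℕ × List ℕ)
  | [] => [(0, [])]
  | x :: w => ((replacements a b w).map fun q => (q.1, x :: q.2)) ++
      bif x == a then (replacements a b w).map fun q => (q.1 + 1, b :: q.2) else []

/-- The coefficient of `t ^ k` after the substitution `a ↦ a + t b`. -/
def shiftCoeff (a b k : ℕ) (A : FormalSum) : FormalSum :=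
  A.flatMap fun p => ((replacements a b p.2).filter fun q => q.1 == k).map fun q => (p.1, q.2)

theorem fst_le_of_mem_replacements {a b : ℕ} {w : List ℕ} {q : ℕ × List ℕ}
    (hq : q ∈ replacements a b w) : q.1 ≤ w.length := by
  induction w generalizing q with
  | nil => simp_all [replacements]
  | cons x w ih =>
    rw [replacements, List.mem_append] at hq
    rcases hq with hq | hq
    · obtain ⟨r, hr, rfl⟩ := List.mem_map.1 hq
      exact (ih hr).trans (by simp)
    · rcases hxa : x == a with _ | _
      · simp [hxa] at hq
      · rw [hxa, cond_true] at hq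
        obtain ⟨r, hr, rfl⟩ := List.mem_map.1 hq
        simpa using ih hr

section

variable {L : Type u} [LieRing L] [LieAlgebra ℂ L]

theorem sum_map_pow_succ_smul (t : ℂ) (z : ℕ → L) (l : List (ℕ × List ℕ)) (y : L) :
    (l.map fun q => t ^ (q.1 + 1) • adTail (q.2.map z) y).sum =
      t • (l.map fun q => t ^ q.1 • adTail (q.2.map z) y).sum := by
  rw [List.smul_sum, List.map_map]
  congr 1
  refine List.map_congr_left fun q _ => ?_
  simp [pow_succ', mul_smul]

/-- The substitution `a ↦ a + t b` in a word is expanded by multilinearity. -/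
theorem adTail_shift (a b : ℕ) (t : ℂ) (z : ℕ → L) (w : List ℕ) (y : L) :
    adTail (w.map (Function.update z a (z a + t • z b))) y =
      ((replacements a b w).map fun q => t ^ q.1 • adTail (q.2.map z) y).sum := by
  induction w generalizing y with
  | nil => simp [replacements, adTail]
  | cons x w ih =>
    rw [List.map_cons, adTail_cons, replacements, List.map_append, List.sum_append, List.map_map]
    rcases eq_or_ne x a with rfl | hx
    · rw [Function.update_self, lie_add, map_add, lie_smul, map_smul, ih, ih, beq_self_eq_true,
        cond_true, List.map_map, ← sum_map_pow_succ_smul]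
      simp only [Function.comp_def, List.map_cons, adTail_cons]
    · rw [Function.update_of_ne hx, ih, beq_false_of_ne hx]
      simp only [Function.comp_def, List.map_cons, adTail_cons, cond_false, List.map_nil,
        List.sum_nil, add_zero]

theorem leftNormed_shift (a b : ℕ) (t : ℂ) (z : ℕ → L) (w : List ℕ) :
    leftNormed (w.map (Function.update z a (z a + t • z b))) =
      ((replacements a b w).map fun q => t ^ q.1 • leftNormed (q.2.map z)).sum := by
  cases w with
  | nil => simp [replacements, leftNormed]
  | cons x w =>
    rw [List.map_cons, leftNormed_cons, replacements, List.map_append, List.sum_append,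
      List.map_map]
    rcases eq_or_ne x a with rfl | hx
    · rw [Function.update_self, map_add, map_smul, adTail_shift, adTail_shift, beq_self_eq_true,
        cond_true, List.map_map, ← sum_map_pow_succ_smul]
      simp only [Function.comp_def, List.map_cons, leftNormed_cons]
    · rw [Function.update_of_ne hx, adTail_shift, beq_false_of_ne hx]
      simp only [Function.comp_def, List.map_cons, leftNormed_cons, cond_false, List.map_nil,
        List.sum_nil, add_zero]

theorem sum_map_eq_sum_range_filter {E : Type*} [AddCommGroup E] [Module ℂ E] (t : ℂ) (m : ℕ)
    (l : List (ℕ × List ℕ)) (hl : ∀ q ∈ l, q.1 < m) (g : List ℕ → E) :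
    (l.map fun q => t ^ q.1 • g q.2).sum =
      ∑ k ∈ Finset.range m, t ^ k • ((l.filter fun q => q.1 == k).map fun q => g q.2).sum := by
  induction l with
  | nil => simp
  | cons q l ih =>
    rw [List.map_cons, List.sum_cons, ih fun r hr => hl r (by simp [hr])]
    have : ∀ k, (((q :: l).filter fun q => q.1 == k).map fun q => g q.2).sum =
        (if q.1 = k then g q.2 else 0) + ((l.filter fun q => q.1 == k).map fun q => g q.2).sum := by
      intro k
      rw [List.filter_cons]
      by_cases h : q.1 = k <;> simp [h]
    simp only [this, smul_add, Finset.sum_add_distrib, smul_ite, smul_zero, Finset.sum_ite_eq,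
      Finset.mem_range, hl q (by simp), if_true]

theorem eval_shift (a b : ℕ) (t : ℂ) (z : ℕ → L) (m : ℕ) (A : FormalSum)
    (hA : ∀ p ∈ A, p.2.length < m) :
    eval (Function.update z a (z a + t • z b)) A =
      ∑ k ∈ Finset.range m, t ^ k • eval z (shiftCoeff a b k A) := by
  induction A with
  | nil => simp [shiftCoeff]
  | cons p A ih =>
    have h : ∀ k, eval z (shiftCoeff a b k (p :: A)) =
        p.1 • (((replacements a b p.2).filter fun q => q.1 == k).map
          fun q => leftNormed (q.2.map z)).sum + eval z (shiftCoeff a b k A) := by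
      intro k
      rw [shiftCoeff, List.flatMap_cons, eval_append, ← shiftCoeff]
      congr 1
      rw [List.smul_sum, eval, List.map_map, List.map_map]
      rfl
    rw [eval_cons, leftNormed_shift, sum_map_eq_sum_range_filter t m _
      (fun q hq => (fst_le_of_mem_replacements hq).trans_lt (hA p (by simp)))
      (fun w => leftNormed (w.map z)), ih fun q hq => hA q (by simp [hq])]
    simp only [h, smul_add, Finset.sum_add_distrib, Finset.smul_sum]
    congr 1
    exact Finset.sum_congr rfl fun k _ => smul_comm _ _ _

/-- The identities that lie in a subspace are stable under the derivation that replaces the letter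
`a` by `b`. -/
theorem sum_smul_eval_shiftCoeff_mem (I : Submodule ℂ L) (a b k : ℕ) {ι : Type*} [Fintype ι]
    (c : ι → ℂ) (A : ι → FormalSum) (m : ℕ) (hA : ∀ i, ∀ p ∈ A i, p.2.length < m) (hk : k < m)
    (h : ∀ z : ℕ → L, ∑ i, c i • eval z (A i) ∈ I) (z : ℕ → L) :
    ∑ i, c i • eval z (shiftCoeff a b k (A i)) ∈ I := by
  refine coeff_mem_of_forall_sum_pow_smul_mem I m
    (fun k => ∑ i, c i • eval z (shiftCoeff a b k (A i))) (fun t => ?_) k hk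
  have := h (Function.update z a (z a + t • z b))
  simp only [eval_shift a b t z m _ (hA _)] at this
  convert this using 1
  simp only [Finset.smul_sum]
  rw [Finset.sum_comm]
  exact Finset.sum_congr rfl fun i _ => Finset.sum_congr rfl fun k _ => smul_comm _ _ _

end

/-- The sum of the operator `F E`, where `E` and `F` are the derivations that replace `1` by `0` and
`0` by `1`, and of a multiple of the substitution `1 ↦ 2 · 1`. The latter separates the weights, and
the eigenvalues of the former on a weight space separate the irreducible representations of `𝔤𝔩₂`
in the homogeneous component. -/
def binaryCasimir (w : List ℕ) : FormalSum :=
  bind (shiftCoeff 0 1 1 (shiftCoeff 1 0 1 [(1, w)])) binaryNormal ++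
    [(10 * (w.map fun x => if x = 1 then 2 else 1).prod, w)]

/-- The eigenvalues and eigenvectors of `binaryCasimir`, in the order of `binaryBasis`. -/
def binaryCasimirTable : List (ℤ × List ℤ) :=
  [(20, [1, 0, 0, 0, 0, 0, 0, 0, 0]),
    (40, [0, -1, 1, 0, 0, 0, 0, 0, 0]),
    (44, [0, -5, 1, 0, 0, 0, 0, 0, 0]),
    (80, [0, 0, 0, -2, 1, 1, 0, 0, 0]),
    (82, [0, 0, 0, -1, 0, 1, 0, 0, 0]),
    (86, [0, 0, 0, -1, 2, 5, 0, 0, 0]),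
    (162, [0, 0, 0, 0, 0, 0, -1, 1, 0]),
    (166, [0, 0, 0, 0, 0, 0, -5, 1, 0]),
    (324, [0, 0, 0, 0, 0, 0, 0, 0, 1])]

theorem isSpectralTable_binaryCasimir :
    IsSpectralTable (opMatrix binaryBasis binaryCasimir) binaryCasimirTable := by
  unfold IsSpectralTable
  decide +kernel

theorem mem_binaryBasis_of_mem_binaryCasimir :
    ∀ w ∈ binaryBasis, ∀ p ∈ binaryCasimir w, p.2 ∈ binaryBasis := by
  decide +kernel

theorem isBinary_of_mem_shiftCoeff : ∀ w ∈ binaryBasis,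
    ∀ p ∈ shiftCoeff 0 1 1 (shiftCoeff 1 0 1 [(1, w)]), IsBinary p.2 := by
  decide +kernel

theorem mem_binaryBasis_of_mem_binaryReduce : ∀ a b c d : Fin 2,
    ∀ p ∈ binaryReduce [0, 1, a, b, c, d], p.2 ∈ binaryBasis := by
  decide

theorem mem_binaryBasis_of_mem_binaryNormal {w : List ℕ} (hw : IsBinary w) {p : ℤ × List ℕ}
    (hp : p ∈ binaryNormal w) : p.2 ∈ binaryBasis := by
  obtain ⟨hl, hx⟩ := hw
  obtain ⟨x, y, a, b, c, d, rfl⟩ : ∃ x y a b c d, w = [x, y, a, b, c, d] := by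
    match w, hl with
    | [x, y, a, b, c, d], _ => exact ⟨x, y, a, b, c, d, rfl⟩
  simp only [List.mem_cons, List.not_mem_nil, or_false, forall_eq_or_imp, forall_eq] at hx
  obtain ⟨hx, hy, ha, hb, hc, hd⟩ := hx
  have key := mem_binaryBasis_of_mem_binaryReduce ⟨a, ha⟩ ⟨b, hb⟩ ⟨c, hc⟩ ⟨d, hd⟩
  interval_cases x <;> interval_cases y
  · simp [binaryNormal] at hp
  · exact key p hp
  · obtain ⟨q, hq, rfl⟩ := List.mem_map.1 hp
    exact key q hq
  · simp [binaryNormal] at hp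

section

variable {L : Type u} [LieRing L] [LieAlgebra ℂ L]

theorem sum_smul_eval_binaryCasimir_mem (I : Submodule ℂ L)
    {c : Fin binaryBasis.length → ℂ} (hc : c ∈ coeffSpace binaryBasis I) (z : ℕ → L) :
    ∑ i, c i • eval z (binaryCasimir (binaryBasis.get i)) ∈ I := by
  have hlen : ∀ w ∈ binaryBasis, w.length < 7 := by decide
  have hlen' : ∀ w ∈ binaryBasis, ∀ p ∈ shiftCoeff 1 0 1 [(1, w)], p.2.length < 7 := by
    decide +kernel
  have h1 : ∀ z : ℕ → L, ∑ i, c i • eval z [(1, binaryBasis.get i)] ∈ I := fun z => by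
    simpa using hc z
  have h2 := sum_smul_eval_shiftCoeff_mem I 1 0 1 c _ 7
    (fun i p hp => by rw [List.mem_singleton.1 hp]; exact hlen _ (List.get_mem _ i)) (by simp) h1
  have h3 := sum_smul_eval_shiftCoeff_mem I 0 1 1 c _ 7
    (fun i p hp => hlen' _ (List.get_mem _ i) p hp) (by simp) h2 z
  have h4 : ∀ i, eval z (binaryCasimir (binaryBasis.get i)) =
      eval z (shiftCoeff 0 1 1 (shiftCoeff 1 0 1 [(1, binaryBasis.get i)])) +
        (10 : ℂ) • leftNormed ((binaryBasis.get i).map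
          fun x => (if x = 1 then 2 else 1 : ℂ) • z x) := by
    intro i
    rw [binaryCasimir, eval_append, eval_bind z _ _ fun p hp =>
      eval_binaryNormal z (isBinary_of_mem_shiftCoeff _ (List.get_mem _ i) p hp),
      leftNormed_map_smul (fun x : ℕ => (if x = 1 then 2 else 1 : ℂ))]
    congr 1
    rw [eval_cons, eval_nil, add_zero, ← Int.cast_smul_eq_zsmul ℂ, smul_smul]
    congr 1
    push_cast
    rw [List.map_map]
    congr 3
    ext x
    simp
  simp only [h4, smul_add, Finset.sum_add_distrib]
  refine add_mem h3 ?_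
  simp only [smul_comm (c _), ← Finset.smul_sum]
  exact I.smul_mem _ (hc _)

theorem spansWords_binaryBasis : SpansWords L binaryBasis {w | IsBinary w} := by
  intro w hw
  rw [Submodule.mem_span_range_iff_exists_fun]
  refine ⟨fun i => ((binaryNormal w).coeff (binaryBasis.get i) : ℂ), ?_⟩
  ext z
  rw [← eval_binaryNormal z hw, eval_eq_sum_coeff z _ binaryBasis.get
    (List.nodup_iff_injective_get.1 (by decide))
    fun p hp => List.mem_iff_get.1 (mem_binaryBasis_of_mem_binaryNormal hw hp)]
  simp [Finset.sum_apply, Int.cast_smul_eq_zsmul]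

end

end FormalSum

open FormalSum in
/-- In the case of at most two generators there are only finitely many homogeneous components of
degree `6` of fully invariant subspaces. -/
theorem finite_inf_wordSpan_six {k : ℕ} (hk : k ≤ 2) :
    ((fun I => I ⊓ wordSpan (Fin k) 6) '' {I | IsFullyInvariant I}).Finite := by
  refine finite_inf_wordSpan (by decide) mem_binaryBasis_of_mem_binaryCasimir
    isSpectralTable_binaryCasimir
    (fun I _ c hc z => sum_smul_eval_binaryCasimir_mem I hc z) ?_
  rintro I I' hI - hle f ⟨hfI, hf⟩
  obtain ⟨c, rfl⟩ := exists_eq_sum_of_mem_wordSpan hf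
  have key := spansWords_binaryBasis.sum_mem hle c
    (fun w : Fin 6 → Fin k => List.ofFn fun p => (w p : ℕ)) (fun w => ?_) (fun z => ?_)
    fun x => if h : x < k then FreeLieAlgebra.of ℂ ⟨x, h⟩ else 0
  · simpa [List.map_ofFn, Function.comp_def] using key
  · refine ⟨by simp, fun x hx => ?_⟩
    obtain ⟨p, rfl⟩ := List.mem_ofFn.1 hx
    exact (w p).isLt.trans_le hk
  · have := hI (FreeLieAlgebra.lift ℂ fun i : Fin k => z i) _ hfI
    rw [map_sum] at this
    simpa [map_leftNormed, List.map_ofFn, Function.comp_def] using this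

/-! ### Finiteness of the set of fully invariant subspaces -/

/-- If there are finitely many possible homogeneous components in each degree up to `ν`, then there
are finitely many fully invariant subspaces with nilpotent quotient of class at most `ν`. -/
theorem finite_isFullyInvariant {X : Type v} {ν : ℕ}
    (h : ∀ n ≤ ν, ((fun I => I ⊓ wordSpan X n) '' {I | IsFullyInvariant I}).Finite) :
    {I | IsFullyInvariant I ∧ ∀ n, ν < n → wordSpan X n ≤ I}.Finite := by
  have hpi := Set.Finite.pi' fun n : Fin (ν + 1) => h n (Nat.lt_succ_iff.1 n.isLt)
  have hle : ∀ I I' : Submodule ℂ (FreeLieAlgebra ℂ X), IsFullyInvariant I →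
      (∀ n, ν < n → wordSpan X n ≤ I') →
      (∀ n : Fin (ν + 1), I ⊓ wordSpan X n = I' ⊓ wordSpan X n) → I ≤ I' := by
    intro I I' hI hI' hII'
    refine hI.le_of_forall_inf_wordSpan_le fun n => ?_
    rcases le_or_gt n ν with hn | hn
    · exact (hII' ⟨n, Nat.lt_succ_iff.2 hn⟩).le.trans inf_le_left
    · exact inf_le_right.trans (hI' n hn)
  refine Set.Finite.of_injOn (f := fun I (n : Fin (ν + 1)) => I ⊓ wordSpan X n)
    (t := {J | ∀ n : Fin (ν + 1), J n ∈ (fun I => I ⊓ wordSpan X n) '' {I | IsFullyInvariant I}})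
    (fun I hI n => ⟨I, hI.1, rfl⟩) (fun I hI I' hI' hII' => ?_) hpi
  exact le_antisymm (hle I I' hI.1 hI'.2 fun n => congrFun hII' n)
    (hle I' I hI'.1 hI.2 fun n => (congrFun hII' n).symm)

/-! ### Presentations of pseudo-free Lie algebras -/

section Presentation

theorem identityIdeal_isFullyInvariant {Y : Type v} (R : Set (FreeLieAlgebra ℂ Y)) (X : Type w) :
    IsFullyInvariant (identityIdeal R (FreeLieAlgebra ℂ X)).toSubmodule := by
  intro ψ x hx
  have hle : identityIdeal R (FreeLieAlgebra ℂ X) ≤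
      (identityIdeal R (FreeLieAlgebra ℂ X)).comap ψ := by
    refine LieSubmodule.lieSpan_le.2 ?_
    rintro _ ⟨φ, r, hr, rfl⟩
    exact LieSubmodule.subset_lieSpan ⟨ψ.comp φ, r, hr, rfl⟩
  exact hle hx

attribute [local instance] LieRing.ofAssociativeRing

variable {X : Type v} {L : Type u} [LieRing L] [LieAlgebra ℂ L]

/-- The coefficient of a generator in the linear part of an element of the free Lie algebra. -/
noncomputable def linearPart (x : X) : FreeLieAlgebra ℂ X →ₗ⁅ℂ⁆ ℂ :=
  open Classical in FreeLieAlgebra.lift ℂ (Pi.single x 1)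

open Classical in
theorem linearPart_of (x y : X) :
    linearPart x (FreeLieAlgebra.of ℂ y) = if y = x then 1 else 0 := by
  simp [linearPart, Pi.single_apply]

theorem linearPart_lie (x : X) (a b : FreeLieAlgebra ℂ X) : linearPart x ⁅a, b⁆ = 0 := by
  rw [LieHom.map_lie, LieRing.of_associative_ring_bracket, mul_comm, sub_self]

/-- The substitution that kills all generators except `x` maps every element to its linear part
in `x`. -/
theorem lift_single_apply (x : X) (a : FreeLieAlgebra ℂ X) :
    open Classical in
    FreeLieAlgebra.lift ℂ (Pi.single x (FreeLieAlgebra.of ℂ x)) a =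
      linearPart x a • FreeLieAlgebra.of ℂ x := by
  classical
  let s : ℂ →ₗ⁅ℂ⁆ FreeLieAlgebra ℂ X :=
    { LinearMap.toSpanSingleton ℂ _ (FreeLieAlgebra.of ℂ x) with
      map_lie' := by
        intro a b
        rw [LieRing.of_associative_ring_bracket, mul_comm, sub_self]
        simp }
  have : FreeLieAlgebra.lift ℂ (Pi.single x (FreeLieAlgebra.of ℂ x)) = s.comp (linearPart x) := by
    refine FreeLieAlgebra.hom_ext fun y => ?_
    rw [FreeLieAlgebra.lift_of_apply, LieHom.comp_apply, linearPart_of]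
    rcases eq_or_ne y x with rfl | h
    · rw [if_pos rfl, Pi.single_eq_same]
      exact (one_smul ℂ _).symm
    · rw [if_neg h, Pi.single_eq_of_ne h]
      exact (zero_smul ℂ _).symm
  exact LieHom.congr_fun this a

/-- Unless the quotient vanishes, a fully invariant ideal contains no element with nonzero linear
part, as this would put a generator, and hence all generators, into the ideal. -/
theorem linearPart_eq_zero [Nontrivial L] (π : FreeLieAlgebra ℂ X →ₗ⁅ℂ⁆ L)
    (hπ : Function.Surjective π) (hker : IsFullyInvariant (π : FreeLieAlgebra ℂ X →ₗ[ℂ] L).ker)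
    {a : FreeLieAlgebra ℂ X} (ha : π a = 0) (x : X) : linearPart x a = 0 := by
  classical
  by_contra hne
  have h1 : π (linearPart x a • FreeLieAlgebra.of ℂ x) = 0 := by
    rw [← lift_single_apply]
    exact hker _ a ha
  have h2 : π (FreeLieAlgebra.of ℂ x) = 0 := by
    rw [map_smul, smul_eq_zero] at h1
    exact h1.resolve_left hne
  have h3 : π = 0 := by
    refine FreeLieAlgebra.hom_ext fun y => ?_
    have := hker (FreeLieAlgebra.lift ℂ fun _ => FreeLieAlgebra.of ℂ y) _ h2
    simpa using this
  obtain ⟨l, hl⟩ := exists_ne (0 : L)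
  obtain ⟨b, rfl⟩ := hπ l
  exact hl (by simp [h3])

/-- The rank of a nonzero relatively free Lie algebra is at most the size of any generating set. -/
theorem finite_and_card_le [Nontrivial L] (π : FreeLieAlgebra ℂ X →ₗ⁅ℂ⁆ L)
    (hπ : Function.Surjective π) (hker : IsFullyInvariant (π : FreeLieAlgebra ℂ X →ₗ[ℂ] L).ker)
    (S : Finset L) (hS : LieSubalgebra.lieSpan ℂ L (S : Set L) = ⊤) :
    Finite X ∧ Nat.card X ≤ S.card := by
  classical
  obtain ⟨σ, hσ⟩ := (π : FreeLieAlgebra ℂ X →ₗ[ℂ] L).exists_rightInverse_of_surjective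
    (LinearMap.range_eq_top.2 hπ)
  have hσ' : ∀ l, π (σ l) = l := fun l => LinearMap.congr_fun hσ l
  -- the abelianization of the Lie algebra, in coordinates
  let Λ : L →ₗ[ℂ] X → ℂ := LinearMap.pi fun x => (linearPart x : _ →ₗ[ℂ] ℂ) ∘ₗ σ
  have hΛ : ∀ a x, Λ (π a) x = linearPart x a := by
    intro a x
    have := linearPart_eq_zero π hπ hker (a := σ (π a) - a) (by rw [map_sub, hσ', sub_self]) x
    rw [map_sub, sub_eq_zero] at this
    exact this
  let A : LieSubalgebra ℂ L :=
    { (Submodule.span ℂ (Λ '' (S : Set L))).comap Λ with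
      lie_mem' := by
        intro l l' _ _
        change Λ ⁅l, l'⁆ ∈ Submodule.span ℂ (Λ '' (S : Set L))
        have : Λ ⁅l, l'⁆ = 0 := by
          obtain ⟨a, rfl⟩ := hπ l
          obtain ⟨b, rfl⟩ := hπ l'
          ext x
          rw [← LieHom.map_lie, hΛ, linearPart_lie]
          rfl
        rw [this]
        exact zero_mem _ }
  have hA : A = ⊤ := by
    rw [eq_top_iff, ← hS]
    exact LieSubalgebra.lieSpan_le.2 fun l hl => Submodule.subset_span ⟨l, hl, rfl⟩
  have hli : LinearIndependent ℂ fun x : X => Λ (π (FreeLieAlgebra.of ℂ x)) := by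
    rw [linearIndependent_iff']
    intro s g hg x hx
    have := congrFun hg x
    simpa [Finset.sum_apply, hΛ, linearPart_of, hx] using this
  have hrange : Set.range (fun x : X => Λ (π (FreeLieAlgebra.of ℂ x))) ⊆
      Submodule.span ℂ ((S.image Λ : Finset (X → ℂ)) : Set (X → ℂ)) := by
    rintro _ ⟨x, rfl⟩
    have : π (FreeLieAlgebra.of ℂ x) ∈ A := hA ▸ LieSubalgebra.mem_top _
    rw [Finset.coe_image]
    exact this
  have hcard := linearIndependent_le_span' _ hli _ hrange
  have hfin : Finite X := hli.finite_of_le_span_finite _ _ hrange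
  refine ⟨hfin, ?_⟩
  have h1 : Nat.card X ≤ (S.image Λ).card := by
    have hcard' : Nat.card X ≤ Fintype.card ((S.image Λ : Finset (X → ℂ)) : Set (X → ℂ)) := by
      rw [← Nat.cast_card] at hcard
      exact_mod_cast hcard
    simpa using hcard'
  exact h1.trans Finset.card_image_le

/-- A pseudo-free Lie algebra with `m` generators is the quotient of a free Lie algebra of rank at
most `m` by a fully invariant ideal. -/
theorem IsPseudoFree.exists_presentation (hL : IsPseudoFree L) {m : ℕ}
    (hm : IsMinimallyGeneratedBy L m) :
    ∃ k ≤ m, ∃ π : FreeLieAlgebra ℂ (Fin k) →ₗ⁅ℂ⁆ L, Function.Surjective π ∧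
      IsFullyInvariant (π : FreeLieAlgebra ℂ (Fin k) →ₗ[ℂ] L).ker := by
  obtain ⟨-, -, Y, R, X, ⟨e⟩⟩ := hL
  obtain ⟨S, hS, rfl⟩ := hm
  rcases subsingleton_or_nontrivial L with hsub | hnt
  · exact ⟨0, Nat.zero_le _, 0, fun l => ⟨0, Subsingleton.elim _ _⟩,
      fun ψ x _ => Subsingleton.elim (α := L) _ _⟩
  let q : FreeLieAlgebra ℂ X →ₗ⁅ℂ⁆ VarietyFreeLieAlgebra R X :=
    { (LieSubmodule.Quotient.mk' (identityIdeal R (FreeLieAlgebra ℂ X)) : _ →ₗ[ℂ] _) with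
      map_lie' := rfl }
  let π₀ : FreeLieAlgebra ℂ X →ₗ⁅ℂ⁆ L := e.symm.toLieHom.comp q
  have hsurj : Function.Surjective π₀ :=
    e.symm.surjective.comp (LieSubmodule.Quotient.surjective_mk' _)
  have hmem : ∀ a, π₀ a = 0 ↔ a ∈ identityIdeal R (FreeLieAlgebra ℂ X) := fun a =>
    (map_eq_zero_iff e.symm e.symm.injective).trans (LieSubmodule.Quotient.mk_eq_zero _)
  have hker : IsFullyInvariant (π₀ : FreeLieAlgebra ℂ X →ₗ[ℂ] L).ker := fun ψ a ha =>
    (hmem _).2 (identityIdeal_isFullyInvariant R X ψ a ((hmem _).1 ha))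
  obtain ⟨hfin, hcard⟩ := finite_and_card_le π₀ hsurj hker S hS.prop
  let φ := Finite.equivFin X
  let f : FreeLieAlgebra ℂ (Fin (Nat.card X)) →ₗ⁅ℂ⁆ FreeLieAlgebra ℂ X :=
    FreeLieAlgebra.lift ℂ fun i => FreeLieAlgebra.of ℂ (φ.symm i)
  let g : FreeLieAlgebra ℂ X →ₗ⁅ℂ⁆ FreeLieAlgebra ℂ (Fin (Nat.card X)) :=
    FreeLieAlgebra.lift ℂ fun x => FreeLieAlgebra.of ℂ (φ x)
  have hfg : ∀ a, f (g a) = a := LieHom.congr_fun (f := f.comp g) (g := LieHom.id)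
    (FreeLieAlgebra.hom_ext fun x => by simp [f, g])
  have hgf : ∀ a, g (f a) = a := LieHom.congr_fun (f := g.comp f) (g := LieHom.id)
    (FreeLieAlgebra.hom_ext fun x => by simp [f, g])
  refine ⟨Nat.card X, hcard, π₀.comp f, fun l => ?_, fun ψ a ha => ?_⟩
  · obtain ⟨a, rfl⟩ := hsurj l
    exact ⟨g a, congrArg π₀ (hfg a)⟩
  · have h : π₀ (f (ψ (g (f a)))) = 0 := hker ((f.comp ψ).comp g) (f a) ha
    rw [hgf] at h
    exact h

/-- Words that are longer than the nilpotency class vanish. -/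
theorem wordSpan_le_ker [LieRing.IsNilpotent L] (π : FreeLieAlgebra ℂ X →ₗ⁅ℂ⁆ L) {n : ℕ}
    (hn : LieModule.nilpotencyLength L L < n) :
    wordSpan X n ≤ (π : FreeLieAlgebra ℂ X →ₗ[ℂ] L).ker := by
  refine Submodule.span_le.2 ?_
  rintro _ ⟨w, rfl, rfl⟩
  change π _ = 0
  rw [map_leftNormed]
  have hbot : LieModule.lowerCentralSeries ℤ L L (LieModule.nilpotencyLength L L) = ⊥ :=
    Nat.sInf_mem (s := {k | LieModule.lowerCentralSeries ℤ L L k = ⊥})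
      (LieModule.IsNilpotent.nilpotent ℤ L L)
  have h := leftNormed_mem_lowerCentralSeries ((w.map (FreeLieAlgebra.of ℂ)).map π)
  rw [List.length_map, List.length_map] at h
  have h' := LieModule.antitone_lowerCentralSeries ℤ L L (Nat.le_sub_one_of_lt hn) h
  rwa [hbot, LieSubmodule.mem_bot] at h'

/-- Quotients of a Lie algebra by the same ideal are isomorphic. -/
theorem nonempty_lieEquiv_of_ker_eq {F : Type v} [LieRing F] [LieAlgebra ℂ F] {L' : Type u}
    [LieRing L'] [LieAlgebra ℂ L'] (π : F →ₗ⁅ℂ⁆ L) (π' : F →ₗ⁅ℂ⁆ L')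
    (hπ : Function.Surjective π) (hπ' : Function.Surjective π')
    (h : (π : F →ₗ[ℂ] L).ker = (π' : F →ₗ[ℂ] L').ker) : Nonempty (L ≃ₗ⁅ℂ⁆ L') := by
  let e := ((π : F →ₗ[ℂ] L).quotKerEquivOfSurjective hπ).symm.trans
    ((Submodule.quotEquivOfEq _ _ h).trans ((π' : F →ₗ[ℂ] L').quotKerEquivOfSurjective hπ'))
  have he : ∀ a, e (π a) = π' a := fun a => by
    have : ((π : F →ₗ[ℂ] L).quotKerEquivOfSurjective hπ).symm (π a) = Submodule.Quotient.mk a := by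
      rw [LinearEquiv.symm_apply_eq]
      rfl
    simp only [e, LinearEquiv.trans_apply, this]
    rfl
  exact ⟨{ e with
    map_lie' := by
      intro x y
      obtain ⟨a, rfl⟩ := hπ x
      obtain ⟨b, rfl⟩ := hπ y
      change e ⁅π a, π b⁆ = ⁅e (π a), e (π b)⁆
      rw [← LieHom.map_lie, he, he, he, LieHom.map_lie] }⟩

end Presentation

theorem mainTheorem4 (m ν : ℕ) (h : ν ≤ 5 ∨ (m = 2 ∧ ν = 6)) :
    (Quotient.mk ComplexLieAlgebra.isoSetoid.{u} ''
      {L : ComplexLieAlgebra.{u} |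
        IsPseudoFree L.carrier ∧
        IsMinimallyGeneratedBy L.carrier m ∧
        LieModule.nilpotencyLength L.carrier L.carrier = ν}).Finite := by
  -- the algebras that are quotients of the free Lie algebra of rank `k`
  let C : ℕ → Set (Quotient ComplexLieAlgebra.isoSetoid.{u}) := fun k =>
    {c | ∃ I : Submodule ℂ (FreeLieAlgebra ℂ (Fin k)),
      I ∈ {I | IsFullyInvariant I ∧ ∀ n, ν < n → wordSpan (Fin k) n ≤ I} ∧
      ∃ (L : ComplexLieAlgebra.{u}) (π : FreeLieAlgebra ℂ (Fin k) →ₗ⁅ℂ⁆ L.carrier),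
        Function.Surjective π ∧ (π : FreeLieAlgebra ℂ (Fin k) →ₗ[ℂ] L.carrier).ker = I ∧
        c = Quotient.mk _ L}
  have hC : ∀ k ≤ m, (C k).Finite := by
    intro k hk
    have hfin : {I | IsFullyInvariant I ∧ ∀ n, ν < n → wordSpan (Fin k) n ≤ I}.Finite := by
      refine finite_isFullyInvariant fun n hn => ?_
      rcases Nat.lt_or_ge 5 n with hn5 | hn5
      · obtain rfl : n = 6 := by omega
        exact finite_inf_wordSpan_six (by omega)
      · exact finite_inf_wordSpan_of_le_five (Fin k) hn5
    have hex : ∀ c ∈ C k, ∃ I, _ := fun c hc => hc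
    choose! I hI hIL using hex
    refine Set.Finite.of_injOn (f := I) hI (fun c hc c' hc' hcc' => ?_) hfin
    obtain ⟨L, π, hπ, hker, rfl⟩ := hIL c hc
    obtain ⟨L', π', hπ', hker', rfl⟩ := hIL c' hc'
    exact Quotient.sound (nonempty_lieEquiv_of_ker_eq π π' hπ hπ'
      (hker.trans (hcc'.trans hker'.symm)))
  refine ((Set.finite_Iic m).biUnion hC).subset ?_
  rintro _ ⟨L, ⟨hL, hm, hν⟩, rfl⟩
  obtain ⟨k, hk, π, hπ, hker⟩ := hL.exists_presentation hm
  have := hL.2.1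
  exact Set.mem_biUnion (Set.mem_Iic.2 hk)
    ⟨_, ⟨hker, fun n hn => wordSpan_le_ker π (hν.trans_lt hn)⟩, L, π, hπ, rfl, rfl⟩
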